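/- Let $X\subseteq\mathbb R^d$ be closed, let $\rho$ be a Borel probability measure on $X\times\mathbb R$ with $\int y^2\,d\rho<\infty$, marginal $\rho_X$ on $X$ and conditional distributions $\rho(\cdot\mid x)$. Put $f_\rho(x)=\int y\,d\rho(y\mid x)$, $\mathcal E(f)=\int (f(x)-y)^2\,d\rho(x,y)$, and let $\|\cdot\|_\rho$ be the norm of $L^2_\rho=L^2(X,\rho_X)$. Let $\mu$ be a probability measure on a measurable space $V$, and let $\phi:V\times X\to\mathbb R$, $\phi_v(x)=\phi(v,x)$, be measurable and square integrable with respect to $\mu\otimes\rho_X$, with $\phi(\cdot,x)\in L^2(\mu)$ for every $x\in X$. Let $$K(x,x')=\int_V\phi_v(x)\phi_v(x')\,d\mu(v)\qquad(x,x'\in X),$$ and let $L_K$ be the integral operator $L_Kf=\int_X f(x)K(x,\cdot)\,d\rho_X(x)$ on $L^2_\rho$. Assume: 1. (Boundedness) $\kappa\ge 1$, $K$ is measurable, $K(x,x)\le\kappa^2$ for all $x\in X$, and $\phi_v(x)\phi_v(x')\le\kappa^2$ for $\mu\otimes\rho_X\otimes\rho_X$-almost all $(v,x,x')$. 2. (Regularity)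 $\zeta>0$, $R>0$ and $\|L_K^{-\zeta}f_\rho\|_\rho\le R$, i.e. $f_\rho=L_K^{\zeta}g$ in $L^2_\rho$ for some $g$ with $\|g\|_\rho\le R$. 3. (Capacity) $\gamma\in[0,1]$, $c_\gamma>0$ and $\operatorname{tr}\big(L_K(L_K+\lambda I)^{-1}\big)\le c_\gamma\lambda^{-\gamma}$ for all $\lambda>0$. Let $T\ge 2$ be an integer, let $(z_t,v_t)=((x_t,y_t),v_t)$, $t=1,\dots,T$, be i.i.d. with distribution $\rho\otimes\mu$, and let $f_1=0$ and $$f_{t+1}=f_t-\eta_t\,(f_t(x_t)-y_t)\,\phi_{v_t}(x_t)\,\phi_{v_t},\qquad \eta_t=\frac{\zeta}{4\kappa^2(c_\gamma+\kappa^2)(\zeta+1)}\,T^{-\frac{\gamma+2\zeta}{\gamma+2\zeta+1}},\qquad t=1,\dots,T.$$ Then $$\mathbb E\big[\|f_{T+1}-f_\rho\|_\rho^2\big]\le C\,T^{-\frac{2\zeta}{2\zeta+\gamma+1}}\ln T,$$ where the constant $C$ depends only on $R,\zeta,\|f_\rho\|_\rho,\mathcal E(f_\rho),\kappa$ and $c_\gamma$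 (and not on $T$, $\gamma$, $d$, or the other data). -/

import Mathlib

open MeasureTheory ProbabilityTheory
open scoped ENNReal InnerProductSpace

noncomputable section

namespace DoublyStochastic

/-! ### Integral operator with a square-integrable kernel on `L²(ν)` -/

section IntegralOperator

variable {X : Type*} [MeasurableSpace X]

/-- The function `x' ↦ ∫ f(x) K(x, x') dν(x)`. -/
def integralTransform (K : X → X → ℝ) (ν : Measure X) (f : X → ℂ) (x' : X) : ℂ :=
  ∫ x, f x * (K x x' : ℂ) ∂ν

/-- `K` is square integrable with respect to `ν ⊗ ν`. -/
def KernelMemL2 (K : X → X → ℝ) (ν : Measure X) : Prop :=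
  MemLp (fun p : X × X => K p.1 p.2) 2 (ν.prod ν)

variable {K : X → X → ℝ} {ν : Measure X}

theorem integrable_mul_of_memLp_two {f g : X → ℂ} (hf : MemLp f 2 ν) (hg : MemLp g 2 ν) :
    Integrable (fun x => f x * g x) ν :=
  memLp_one_iff_integrable.1 (hg.mul' (p := 2) (q := 2) (r := 1) hf)

theorem integralTransform_congr {f g : X → ℂ} (h : f =ᵐ[ν] g) :
    integralTransform K ν f = integralTransform K ν g := by
  funext x'
  exact integral_congr_ae (h.mono fun x hx => by simp only [hx])

variable [SFinite ν]

theorem KernelMemL2.ae_memLp (hK : KernelMemL2 K ν) :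
    ∀ᵐ x' ∂ν, MemLp (fun x => (K x x' : ℂ)) 2 ν := by
  have h1 : AEStronglyMeasurable (fun p : X × X => K p.2 p.1) (ν.prod ν) :=
    hK.1.prod_swap
  have h2 : Integrable (fun p : X × X => (K p.2 p.1) ^ 2) (ν.prod ν) :=
    ((memLp_two_iff_integrable_sq hK.1).1 hK).swap
  filter_upwards [h1.prodMk_left, h2.prod_right_ae] with x' h3 h4
  exact ((memLp_two_iff_integrable_sq h3).2 h4).ofReal

theorem integralTransform_enorm_sq_le (f : X → ℂ) (hf : MemLp f 2 ν) (hK : KernelMemL2 K ν) :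
    ∀ᵐ x' ∂ν, ‖integralTransform K ν f x'‖ₑ ^ 2 ≤
      eLpNorm f 2 ν ^ 2 * ∫⁻ x, ‖K x x'‖ₑ ^ 2 ∂ν := by
  filter_upwards [hK.ae_memLp] with x' h
  have h1 : ‖integralTransform K ν f x'‖ₑ ≤
      eLpNorm f 2 ν * eLpNorm (fun x => (K x x' : ℂ)) 2 ν := by
    refine (enorm_integral_le_lintegral_enorm _).trans ?_
    have h2 := eLpNorm_smul_le_mul_eLpNorm (p := 2) (q := 2) (r := 1) h.1 hf.1
    simpa [eLpNorm_one_eq_lintegral_enorm] using h2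
  have h3 : eLpNorm (fun x => (K x x' : ℂ)) 2 ν ^ 2 = ∫⁻ x, ‖K x x'‖ₑ ^ 2 ∂ν := by
    have := eLpNorm_nnreal_pow_eq_lintegral (μ := ν) (f := fun x => (K x x' : ℂ))
      (p := 2) (by norm_num)
    have h4 : ∀ x, ‖(K x x' : ℂ)‖ₑ = ‖K x x'‖ₑ := fun x => by
      rw [← ofReal_norm, ← ofReal_norm, Complex.norm_real]
    simpa [h4] using this
  calc ‖integralTransform K ν f x'‖ₑ ^ 2
      ≤ (eLpNorm f 2 ν * eLpNorm (fun x => (K x x' : ℂ)) 2 ν) ^ 2 := by gcongr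
    _ = _ := by rw [mul_pow, h3]

theorem integralTransform_aestronglyMeasurable (f : X → ℂ) (hf : MemLp f 2 ν)
    (hK : KernelMemL2 K ν) : AEStronglyMeasurable (integralTransform K ν f) ν := by
  have h1 : AEStronglyMeasurable (fun p : X × X => f p.2 * (K p.2 p.1 : ℂ)) (ν.prod ν) :=
    hf.1.comp_snd.mul (Complex.continuous_ofReal.comp_aestronglyMeasurable hK.1.prod_swap)
  exact h1.integral_prod_right'

theorem eLpNorm_integralTransform_le (f : X → ℂ) (hf : MemLp f 2 ν) (hK : KernelMemL2 K ν) :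
    eLpNorm (integralTransform K ν f) 2 ν ≤
      eLpNorm (fun p : X × X => K p.1 p.2) 2 (ν.prod ν) * eLpNorm f 2 ν := by
  have e2 : ∀ {Y E : Type _} [MeasurableSpace Y] [NormedAddCommGroup E] (g : Y → E)
      (m : Measure Y), eLpNorm g 2 m ^ 2 = ∫⁻ y, ‖g y‖ₑ ^ 2 ∂m := by
    intro Y E _ _ g m
    simpa using eLpNorm_nnreal_pow_eq_lintegral (μ := m) (f := g) (p := 2) (by norm_num)
  have hm : AEMeasurable (fun p : X × X => ‖K p.2 p.1‖ₑ ^ 2) (ν.prod ν) :=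
    (hK.1.prod_swap.enorm).pow_const 2
  have h : eLpNorm (integralTransform K ν f) 2 ν ^ 2 ≤
      (eLpNorm (fun p : X × X => K p.1 p.2) 2 (ν.prod ν) * eLpNorm f 2 ν) ^ 2 := by
    calc eLpNorm (integralTransform K ν f) 2 ν ^ 2
        = ∫⁻ x', ‖integralTransform K ν f x'‖ₑ ^ 2 ∂ν := e2 _ _
      _ ≤ ∫⁻ x', eLpNorm f 2 ν ^ 2 * ∫⁻ x, ‖K x x'‖ₑ ^ 2 ∂ν ∂ν :=
          lintegral_mono_ae (integralTransform_enorm_sq_le f hf hK)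
      _ = eLpNorm f 2 ν ^ 2 * ∫⁻ x', ∫⁻ x, ‖K x x'‖ₑ ^ 2 ∂ν ∂ν :=
          lintegral_const_mul' _ _ (ENNReal.pow_ne_top hf.2.ne)
      _ = eLpNorm f 2 ν ^ 2 * ∫⁻ p, ‖K p.2 p.1‖ₑ ^ 2 ∂(ν.prod ν) := by
          rw [lintegral_prod _ hm]
      _ = eLpNorm f 2 ν ^ 2 * ∫⁻ p : X × X, ‖K p.1 p.2‖ₑ ^ 2 ∂(ν.prod ν) := by
          rw [← lintegral_prod_swap (μ := ν) (ν := ν)]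
          rfl
      _ = _ := by rw [← e2 (fun p : X × X => K p.1 p.2), mul_pow, mul_comm]
  exact (ENNReal.pow_le_pow_left_iff two_ne_zero).1 h

theorem memLp_integralTransform (f : X → ℂ) (hf : MemLp f 2 ν) (hK : KernelMemL2 K ν) :
    MemLp (integralTransform K ν f) 2 ν :=
  ⟨integralTransform_aestronglyMeasurable f hf hK,
    (eLpNorm_integralTransform_le f hf hK).trans_lt (ENNReal.mul_lt_top hK.2 hf.2)⟩

/-- The operator `f ↦ ∫ f(x) K(x, ·) dν(x)` on `L²(ν)`, for `K ∈ L²(ν ⊗ ν)`. -/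
def integralOperatorOfMem (hK : KernelMemL2 K ν) : Lp ℂ 2 ν →L[ℂ] Lp ℂ 2 ν :=
  LinearMap.mkContinuous
    { toFun := fun f => (memLp_integralTransform f (Lp.memLp f) hK).toLp
      map_add' := by
        intro f g
        rw [← MemLp.toLp_add, MemLp.toLp_eq_toLp_iff, integralTransform_congr (Lp.coeFn_add f g)]
        filter_upwards [hK.ae_memLp] with x' h
        simp only [integralTransform, Pi.add_apply, add_mul]
        exact integral_add (integrable_mul_of_memLp_two (Lp.memLp f) h)
          (integrable_mul_of_memLp_two (Lp.memLp g) h)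
      map_smul' := by
        intro c f
        rw [RingHom.id_apply, ← MemLp.toLp_const_smul, MemLp.toLp_eq_toLp_iff,
          integralTransform_congr (Lp.coeFn_smul c f)]
        refine Filter.Eventually.of_forall fun x' => ?_
        simp only [integralTransform, Pi.smul_apply, smul_eq_mul, mul_assoc]
        exact integral_const_mul _ _ }
    (eLpNorm (fun p : X × X => K p.1 p.2) 2 (ν.prod ν)).toReal (by
      intro f
      rw [LinearMap.coe_mk, AddHom.coe_mk, Lp.norm_toLp, Lp.norm_def, ← ENNReal.toReal_mul]
      exact ENNReal.toReal_mono (ENNReal.mul_ne_top hK.2.ne (Lp.eLpNorm_ne_top f))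
        (eLpNorm_integralTransform_le f (Lp.memLp f) hK))

open Classical in
/-- The integral operator `L_K f = ∫ f(x) K(x, ·) dν(x)` on `L²(ν)`. Scalars are complex (the
complexification of the real `L²(ν)`), so that Mathlib's functional calculus applies; the kernel is
real. For kernels outside `L²(ν ⊗ ν)` the value is the dummy `0`. -/
def integralOperator (K : X → X → ℝ) (ν : Measure X) [SFinite ν] : Lp ℂ 2 ν →L[ℂ] Lp ℂ 2 ν :=
  if hK : KernelMemL2 K ν then integralOperatorOfMem hK else 0

theorem coeFn_integralOperator (hK : KernelMemL2 K ν) (f : Lp ℂ 2 ν) :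
    integralOperator K ν f =ᵐ[ν] fun x' => ∫ x, f x * (K x x' : ℂ) ∂ν := by
  rw [integralOperator, dif_pos hK]
  exact MemLp.coeFn_toLp (memLp_integralTransform f (Lp.memLp f) hK)

end IntegralOperator

/-! ### Powers, trace and effective dimension of operators on a Hilbert space -/

section Operators

variable {H : Type*} [NormedAddCommGroup H] [InnerProductSpace ℂ H] [CompleteSpace H]

/-- The power `L ^ s` of a positive operator, by the continuous functional calculus. -/
def opPow (L : H →L[ℂ] H) (s : ℝ) : H →L[ℂ] H := L ^ s

variable (H) in
/-- A Hilbert basis of `H`. -/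
def hilbertBasis : HilbertBasis (exists_hilbertBasis ℂ H).choose ℂ H :=
  (exists_hilbertBasis ℂ H).choose_spec.choose

/-- The trace `∑ ⟪eᵢ, A eᵢ⟫ ∈ [0, ∞]` of a positive operator `A` (it does not depend on the Hilbert
basis). -/
def opTrace (A : H →L[ℂ] H) : ℝ≥0∞ :=
  ∑' i, ENNReal.ofReal (⟪hilbertBasis H i, A (hilbertBasis H i)⟫_ℂ).re

/-- The effective dimension `tr (L (L + lam I)⁻¹)`. -/
def effectiveDimension (L : H →L[ℂ] H) (lam : ℝ) : ℝ≥0∞ :=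
  opTrace (L * Ring.inverse (L + (lam : ℂ) • (1 : H →L[ℂ] H)))

end Operators

/-! ### The learning problem -/

section Learning

variable {X : Type*} [MeasurableSpace X]

/-- The regression function `f_ρ(x) = ∫ y dρ(y | x)`. -/
def regressionFunction (ρ : Measure (X × ℝ)) [IsFiniteMeasure ρ] (x : X) : ℝ :=
  ∫ y, y ∂(ρ.condKernel x)

/-- The expected risk `𝓔(f) = ∫ (f(x) - y)² dρ(x, y)`. -/
def expectedRisk (ρ : Measure (X × ℝ)) (f : X → ℝ) : ℝ :=
  ∫ z, (f z.1 - z.2) ^ 2 ∂ρ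

/-- The norm `‖f‖_ρ` of `L²(ρ_X)`, as an extended real number; `ρ.fst` is the marginal `ρ_X`. -/
def rhoNorm (ρ : Measure (X × ℝ)) (f : X → ℝ) : ℝ≥0∞ := eLpNorm f 2 ρ.fst

/-- The operator `L_K` on `L²(ρ_X)`. -/
def LK (K : X → X → ℝ) (ρ : Measure (X × ℝ)) [IsFiniteMeasure ρ] :
    Lp ℂ 2 ρ.fst →L[ℂ] Lp ℂ 2 ρ.fst :=
  integralOperator K ρ.fst

variable {V : Type*} [MeasurableSpace V]

/-- `φ` is a measurable random feature, square integrable with respect to `μ ⊗ ρ_X`, with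
`K(x, x') = ⟪φ(·, x), φ(·, x')⟫` in `L²(μ)` for all `x, x'`. -/
structure IsRandomFeature (K : X → X → ℝ) (μ : Measure V) (φ : V → X → ℝ) (ρ : Measure (X × ℝ)) :
    Prop where
  measurable : Measurable (fun p : V × X => φ p.1 p.2)
  memLp_prod : MemLp (fun p : V × X => φ p.1 p.2) 2 (μ.prod ρ.fst)
  memLp_section : ∀ x, MemLp (fun v => φ v x) 2 μ
  kernel_eq : ∀ x x', K x x' = ∫ v, φ v x * φ v x' ∂μ

/-- Boundedness: `K(x, x) ≤ κ²` for all `x`, and `φ_v(x) φ_v(x') ≤ κ²` almost surely. -/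
structure BoundedBy (κ : ℝ) (K : X → X → ℝ) (μ : Measure V) (φ : V → X → ℝ)
    (ρ : Measure (X × ℝ)) : Prop where
  one_le : 1 ≤ κ
  measurable_kernel : Measurable (fun p : X × X => K p.1 p.2)
  kernel_le : ∀ x, K x x ≤ κ ^ 2
  feature_le : ∀ᵐ p ∂(μ.prod (ρ.fst.prod ρ.fst)), φ p.1 p.2.1 * φ p.1 p.2.2 ≤ κ ^ 2

/-- Regularity: `‖L_K^{-ζ} f_ρ‖_ρ ≤ R`, that is, `f_ρ = L_K^ζ g` for some `g ∈ L²(ρ_X)` with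
`‖g‖_ρ ≤ R`. -/
def SourceCondition (ζ R : ℝ) (K : X → X → ℝ) (ρ : Measure (X × ℝ)) [IsFiniteMeasure ρ] : Prop :=
  ∃ g : Lp ℂ 2 ρ.fst, ‖g‖ ≤ R ∧
    (opPow (LK K ρ) ζ g : X → ℂ) =ᵐ[ρ.fst] fun x => (regressionFunction ρ x : ℂ)

/-- Capacity: `tr (L_K (L_K + lam I)⁻¹) ≤ c_γ lam^{-γ}` for all `lam > 0`. -/
def CapacityCondition (γ cγ : ℝ) (K : X → X → ℝ) (ρ : Measure (X × ℝ)) [IsFiniteMeasure ρ] :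
    Prop :=
  ∀ lam : ℝ, 0 < lam → effectiveDimension (LK K ρ) lam ≤ ENNReal.ofReal (cγ * lam ^ (-γ))

/-- The doubly stochastic learning algorithm with step sizes `η`, regularization parameter `lam`,
samples `z` and features `φ_{v t}`. Everything is indexed from `0`: `iterate … t`, `z t`, `v t` and
`η t` stand for `f_{t+1}`, `z_{t+1} = (x_{t+1}, y_{t+1})`, `v_{t+1}` and `η_{t+1}`. -/
def iterate (φ : V → X → ℝ) (η : ℕ → ℝ) (lam : ℝ) (z : ℕ → X × ℝ) (v : ℕ → V) : ℕ → X → ℝ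
  | 0 => fun _ => 0
  | t + 1 => fun x =>
      (1 - η t * lam) * iterate φ η lam z v t x
        - η t * (iterate φ η lam z v t (z t).1 - (z t).2) * φ (v t) (z t).1 * φ (v t) x

/-- The constant step size `ζ / (4 κ² (c_γ + κ²) (ζ + 1)) · T^{-(γ + 2ζ)/(γ + 2ζ + 1)}`. -/
def stepSize (κ cγ γ ζ : ℝ) (T : ℕ) : ℝ :=
  ζ / (4 * κ ^ 2 * (cγ + κ ^ 2) * (ζ + 1)) * (T : ℝ) ^ (-((γ + 2 * ζ) / (γ + 2 * ζ + 1)))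

end Learning

end DoublyStochastic

end

/-! Write `r_t` for the error `f_t - f_ρ` in `L²(ρ_X)`, `L` for `L_K` and `η` for the step size.
Given the past, the mean of the stochastic gradient is `L r_t`, so expanding the square gives, for
every bounded operator `B`, `E‖B r_{t+1}‖² ≤ E‖B(1 - ηL) r_t‖² + η²κ² (E‖r_t‖² + 𝓔(f_ρ)) ∫‖B φ_v‖²
dμ` (`IsBoundedFeature.lintegral_norm_step_le`). The operators `B = (1 - ηL)^k` are stable under
this step, and the noise involves only the column `k = 0`. Once that column is known to stay below
some `M`, unrolling bounds the final error by a bias `‖(1 - ηL)^T f_ρ‖²` plus a variance `η²κ² (M +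
𝓔(f_ρ)) ∑_{k<T} τ_k` with `τ_k = ∫‖(1 - ηL)^k φ_v‖² dμ` (`le_of_triangular_recursion`,
`IsBoundedFeature.meanSqError_le`).

The source condition makes the bias `O((ηT)^(-2ζ))`. Since `L` is the mean of `φ_v ⊗ φ_v`, the trace
of `L(L + λ)⁻¹` is the mean of `‖(L + λ)^(-1/2) φ_v‖²`; with `λ = 1/(2ηk)` the capacity condition
yields `τ_k ≤ 2 c_γ λ^(1-γ)`. Summing over `k` makes the variance `O(η (ηT)^γ log T)`, up to the
term `k = 0`. The step size balances bias and variance, and its constant is small enough for `M =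
3‖f_ρ‖² + 3𝓔(f_ρ)` to reproduce itself. -/

noncomputable section

namespace DoublyStochastic

/-! ### Scalar inequalities lifted to operators by the functional calculus. -/

section SpectralBounds

variable {H : Type*} [NormedAddCommGroup H] [InnerProductSpace ℂ H] [CompleteSpace H]

theorem spectrum_subset_Icc {L : H →L[ℂ] H} (hL : 0 ≤ L) {M : ℝ} (hM : ‖L‖ ≤ M) {x : ℝ}
    (hx : x ∈ spectrum ℝ L) : 0 ≤ x ∧ x ≤ M := by
  refine ⟨spectrum_nonneg_of_nonneg hL hx, ?_⟩
  -- Bounding the spectrum by the norm needs `‖1‖ = 1`; on the zero space the spectrum is empty.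
  have h1 : Nontrivial H := by
    by_contra h
    rw [not_nontrivial_iff_subsingleton] at h
    have : Subsingleton (H →L[ℂ] H) := inferInstance
    rw [spectrum.of_subsingleton] at hx
    exact hx
  have := spectrum.norm_le_norm_of_mem hx
  exact (le_abs_self x).trans (this.trans hM)

/-- `(1 - eta L) ^ k` through the functional calculus. -/
theorem one_sub_smul_pow_eq_cfc {L : H →L[ℂ] H} (hL : 0 ≤ L) (eta : ℝ) (k : ℕ) :
    (1 - (eta : ℂ) • L) ^ k = cfc (fun x : ℝ => (1 - eta * x) ^ k) L := by
  have hsa : IsSelfAdjoint L := .of_nonneg hL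
  rw [cfc_pow (fun x : ℝ => 1 - eta * x) k L, cfc_sub (fun _ : ℝ => (1 : ℝ)) (fun x => eta * x) L,
    cfc_const_one ℝ L, cfc_const_mul_id eta L]
  rfl

theorem ringInverse_add_smul_one_eq_cfc {L : H →L[ℂ] H} (hL : 0 ≤ L) {lam : ℝ} (hlam : 0 < lam) :
    Ring.inverse (L + (lam : ℂ) • (1 : H →L[ℂ] H)) = cfc (fun x : ℝ => (x + lam)⁻¹) L := by
  have hsa : IsSelfAdjoint L := .of_nonneg hL
  have hpos : ∀ x ∈ spectrum ℝ L, x + lam ≠ 0 := fun x hx =>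
    (add_pos_of_nonneg_of_pos (spectrum_nonneg_of_nonneg hL hx) hlam).ne'
  have hc : ContinuousOn (fun x : ℝ => (x + lam)⁻¹) (spectrum ℝ L) :=
    ContinuousOn.inv₀ (by fun_prop) hpos
  have h0 : L + (lam : ℂ) • (1 : H →L[ℂ] H) = cfc (fun x : ℝ => x + lam) L := by
    rw [cfc_add_const lam (fun x : ℝ => x) L, cfc_id' ℝ L, Algebra.algebraMap_eq_smul_one]
    rfl
  have h1 : (L + (lam : ℂ) • (1 : H →L[ℂ] H)) * cfc (fun x : ℝ => (x + lam)⁻¹) L = 1 := by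
    rw [h0, ← cfc_mul (fun x : ℝ => x + lam) _ L (by fun_prop) hc, ← cfc_const_one ℝ L]
    exact cfc_congr fun x hx => mul_inv_cancel₀ (hpos x hx)
  have h2 : cfc (fun x : ℝ => (x + lam)⁻¹) L * (L + (lam : ℂ) • (1 : H →L[ℂ] H)) = 1 := by
    rw [h0, ← cfc_mul _ (fun x : ℝ => x + lam) L hc (by fun_prop), ← cfc_const_one ℝ L]
    exact cfc_congr fun x hx => inv_mul_cancel₀ (hpos x hx)
  exact Ring.inverse_unit ⟨_, _, h1, h2⟩

/-- The operator `(L + lam)^(-1/2)`. -/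
def resolventSqrt (L : H →L[ℂ] H) (lam : ℝ) : H →L[ℂ] H :=
  cfc (fun x : ℝ => (√(x + lam))⁻¹) L

theorem isSelfAdjoint_resolventSqrt (L : H →L[ℂ] H) (lam : ℝ) :
    IsSelfAdjoint (resolventSqrt L lam) :=
  cfc_predicate _ L

theorem continuousOn_inv_sqrt_add {L : H →L[ℂ] H} (hL : 0 ≤ L) {lam : ℝ} (hlam : 0 < lam) :
    ContinuousOn (fun x : ℝ => (√(x + lam))⁻¹) (spectrum ℝ L) :=
  ContinuousOn.inv₀ (by fun_prop) fun _ hx =>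
    (Real.sqrt_pos.2 (add_pos_of_nonneg_of_pos (spectrum_nonneg_of_nonneg hL hx) hlam)).ne'

/-- The symmetric form `S L S` lets the effective dimension be read as the mean of `‖S Φ(v)‖²`. -/
theorem resolventSqrt_mul_mul_resolventSqrt {L : H →L[ℂ] H} (hL : 0 ≤ L) {lam : ℝ}
    (hlam : 0 < lam) :
    resolventSqrt L lam * L * resolventSqrt L lam =
      L * Ring.inverse (L + (lam : ℂ) • (1 : H →L[ℂ] H)) := by
  have hsa : IsSelfAdjoint L := .of_nonneg hL
  have hc := continuousOn_inv_sqrt_add hL hlam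
  have hpos : ∀ x ∈ spectrum ℝ L, 0 < x + lam := fun x hx =>
    add_pos_of_nonneg_of_pos (spectrum_nonneg_of_nonneg hL hx) hlam
  have hc' : ContinuousOn (fun x : ℝ => (x + lam)⁻¹) (spectrum ℝ L) :=
    ContinuousOn.inv₀ (by fun_prop) fun x hx => (hpos x hx).ne'
  have h1 : resolventSqrt L lam * L * resolventSqrt L lam =
      cfc (fun x : ℝ => (√(x + lam))⁻¹ * x * (√(x + lam))⁻¹) L := by
    rw [cfc_mul (fun x : ℝ => (√(x + lam))⁻¹ * x) _ L (hc.mul continuousOn_id) hc,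
      cfc_mul (fun x : ℝ => (√(x + lam))⁻¹) (fun x : ℝ => x) L hc continuousOn_id, cfc_id' ℝ L]
    rfl
  have h2 : L * cfc (fun x : ℝ => (x + lam)⁻¹) L = cfc (fun x : ℝ => x * (x + lam)⁻¹) L := by
    rw [cfc_mul (fun x : ℝ => x) _ L continuousOn_id hc', cfc_id' ℝ L]
  rw [ringInverse_add_smul_one_eq_cfc hL hlam, h1, h2]
  refine cfc_congr fun x hx => ?_
  have h := Real.mul_self_sqrt (hpos x hx).le
  change (√(x + lam))⁻¹ * x * (√(x + lam))⁻¹ = x * (x + lam)⁻¹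
  rw [mul_comm _ x, mul_assoc, ← mul_inv, h]

/-- With `u = eta * x`: `(1 - u)^m (1 + u)^m ≤ 1`, and Bernoulli gives `(1 + u)^m ≥ 1 + m u`, hence
`m u (1 - u)^m ≤ 1`. -/
theorem mul_one_sub_pow_le {eta x : ℝ} (m : ℕ) (heta : 0 < eta) (hm : 0 < m) (hx : 0 ≤ x)
    (hx1 : eta * x ≤ 1) : x * (1 - eta * x) ^ m ≤ (eta * m)⁻¹ := by
  have hm' : (0 : ℝ) < m := by exact_mod_cast hm
  have h0 : 0 ≤ 1 - eta * x := by linarith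
  have h1 : 1 + m * (eta * x) ≤ (1 + eta * x) ^ m :=
    one_add_mul_le_pow (by nlinarith [mul_nonneg heta.le hx]) m
  have h2 : (1 - eta * x) ^ m * (1 + eta * x) ^ m ≤ 1 := by
    rw [← mul_pow]
    exact pow_le_one₀ (mul_nonneg h0 (by nlinarith [mul_nonneg heta.le hx]))
      (by nlinarith [sq_nonneg (eta * x)])
  have h3 : 0 ≤ (1 - eta * x) ^ m := pow_nonneg h0 m
  have h4 := mul_le_mul_of_nonneg_left h1 h3
  rw [← one_div, le_div_iff₀ (by positivity)]
  nlinarith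

/-- Factor `(1 - eta L)^k` through `(L + lam)^(-1/2)`. The remaining symbol has square `(1 - eta
x)^(2k) (x + lam)`, and its two summands are bounded separately. -/
theorem norm_one_sub_smul_pow_apply_le {L : H →L[ℂ] H} (hL : 0 ≤ L) {M eta lam : ℝ}
    (hM : ‖L‖ ≤ M) (heta : 0 < eta) (hetaM : eta * M ≤ 1) (hlam : 0 < lam) {k : ℕ} (hk : 0 < k)
    (u : H) :
    ‖((1 - (eta : ℂ) • L) ^ k) u‖ ^ 2 ≤
      ((eta * (2 * k : ℕ))⁻¹ + lam) * ‖resolventSqrt L lam u‖ ^ 2 := by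
  have hsa : IsSelfAdjoint L := .of_nonneg hL
  have hc := continuousOn_inv_sqrt_add hL hlam
  set c : ℝ := (eta * (2 * k : ℕ))⁻¹ + lam with hcdef
  have hc0 : 0 ≤ c := by positivity
  have h1 : (1 - (eta : ℂ) • L) ^ k =
      cfc (fun x : ℝ => (1 - eta * x) ^ k * √(x + lam)) L * resolventSqrt L lam := by
    rw [one_sub_smul_pow_eq_cfc hL, resolventSqrt, ← cfc_mul _ _ L (by fun_prop) hc]
    refine cfc_congr fun x hx => ?_
    have : √(x + lam) ≠ 0 := (Real.sqrt_pos.2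
      (add_pos_of_nonneg_of_pos (spectrum_nonneg_of_nonneg hL hx) hlam)).ne'
    rw [mul_assoc, mul_inv_cancel₀ this, mul_one]
  have h2 : ‖cfc (fun x : ℝ => (1 - eta * x) ^ k * √(x + lam)) L‖ ≤ √c := by
    refine norm_cfc_le (Real.sqrt_nonneg _) fun x hx => ?_
    obtain ⟨hx0, hxM⟩ := spectrum_subset_Icc hL hM hx
    have hx1 : eta * x ≤ 1 := (mul_le_mul_of_nonneg_left hxM heta.le).trans hetaM
    refine Real.le_sqrt_of_sq_le ?_
    rw [Real.norm_eq_abs, sq_abs, mul_pow, Real.sq_sqrt (by positivity), ← pow_mul, mul_comm k 2]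
    have h3 := mul_one_sub_pow_le (2 * k) heta (by positivity) hx0 hx1
    have h4 : (1 - eta * x) ^ (2 * k) ≤ 1 :=
      pow_le_one₀ (by linarith) (by nlinarith [mul_nonneg heta.le hx0])
    nlinarith
  rw [h1]
  calc ‖(cfc (fun x : ℝ => (1 - eta * x) ^ k * √(x + lam)) L) (resolventSqrt L lam u)‖ ^ 2
      ≤ (√c * ‖resolventSqrt L lam u‖) ^ 2 := by
        gcongr
        exact ContinuousLinearMap.le_of_opNorm_le _ h2 _
    _ = _ := by rw [mul_pow, Real.sq_sqrt hc0]

/-- As `1 - eta x ≤ exp(-eta x)`, the substitution `u = eta T x / z` reduces the claim to `u exp(-u)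
≤ 1`. -/
theorem one_sub_pow_mul_rpow_le {eta x z : ℝ} {T : ℕ} (hT : 0 < T) (heta : 0 < eta) (hz : 0 < z)
    (hx : 0 ≤ x) (hx1 : eta * x ≤ 1) :
    (1 - eta * x) ^ T * x ^ z ≤ (z / (eta * T)) ^ z := by
  have hT' : (0 : ℝ) < T := by exact_mod_cast hT
  set u : ℝ := eta * T * x / z with hu
  have hu0 : 0 ≤ u := by positivity
  have h1 : (1 - eta * x) ^ T ≤ (Real.exp (-u)) ^ z := by
    rw [← Real.exp_mul, show -u * z = (T : ℕ) * (-(eta * x)) by rw [hu]; field_simp,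
      Real.exp_nat_mul]
    exact pow_le_pow_left₀ (by linarith) (by linarith [Real.add_one_le_exp (-(eta * x))]) T
  have h2 : x = u * (z / (eta * T)) := by rw [hu]; field_simp
  have h3 : Real.exp (-u) * u ≤ 1 := by
    rw [Real.exp_neg, inv_mul_le_iff₀ (Real.exp_pos u)]
    linarith [Real.add_one_le_exp u]
  calc (1 - eta * x) ^ T * x ^ z ≤ (Real.exp (-u)) ^ z * x ^ z := by gcongr
    _ = (Real.exp (-u) * u) ^ z * (z / (eta * T)) ^ z := by
      conv_lhs => rw [h2]
      rw [Real.mul_rpow hu0 (by positivity), Real.mul_rpow (by positivity) hu0, mul_assoc]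
    _ ≤ 1 * (z / (eta * T)) ^ z := by
      gcongr
      exact Real.rpow_le_one (by positivity) h3 hz.le
    _ = _ := one_mul _

theorem norm_one_sub_smul_pow_opPow_le {L : H →L[ℂ] H} (hL : 0 ≤ L) {M eta z : ℝ}
    (hM : ‖L‖ ≤ M) (heta : 0 < eta) (hetaM : eta * M ≤ 1) (hz : 0 < z) {T : ℕ} (hT : 0 < T)
    (g : H) :
    ‖((1 - (eta : ℂ) • L) ^ T) (opPow L z g)‖ ≤ (z / (eta * T)) ^ z * ‖g‖ := by
  have hsa : IsSelfAdjoint L := .of_nonneg hL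
  have hc : ContinuousOn (fun x : ℝ => x ^ z) (spectrum ℝ L) :=
    (Real.continuous_rpow_const hz.le).continuousOn
  have h1 : (1 - (eta : ℂ) • L) ^ T * opPow L z =
      cfc (fun x : ℝ => (1 - eta * x) ^ T * x ^ z) L := by
    rw [opPow, CFC.rpow_eq_cfc_real (ha := hL), one_sub_smul_pow_eq_cfc hL,
      ← cfc_mul _ _ L (by fun_prop) hc]
  have h2 : ‖cfc (fun x : ℝ => (1 - eta * x) ^ T * x ^ z) L‖ ≤ (z / (eta * T)) ^ z := by
    refine norm_cfc_le (by positivity) fun x hx => ?_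
    obtain ⟨hx0, hxM⟩ := spectrum_subset_Icc hL hM hx
    have hx1 : eta * x ≤ 1 := (mul_le_mul_of_nonneg_left hxM heta.le).trans hetaM
    rw [Real.norm_of_nonneg
      (mul_nonneg (pow_nonneg (by linarith) _) (Real.rpow_nonneg hx0 _))]
    exact one_sub_pow_mul_rpow_le hT heta hz hx0 hx1
  rw [← mul_apply_eq_comp, h1]
  exact ContinuousLinearMap.le_of_opNorm_le _ h2 _

end SpectralBounds

/-! ### Means of random rank one operators and their traces. -/

section RandomRankOne

variable {H : Type*} [NormedAddCommGroup H] [InnerProductSpace ℂ H]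
variable {V : Type*} [MeasurableSpace V]

/-- Basis vectors are `√2` apart, so balls of radius `1/2` about them are disjoint. Countability is
what allows sum and integral to be exchanged in the trace formula. -/
theorem _root_.HilbertBasis.countable_of_separableSpace [TopologicalSpace.SeparableSpace H]
    {ι : Type*} (b : HilbertBasis ι ℂ H) : Countable ι := by
  have h : Pairwise (Function.onFun Disjoint fun i => Metric.ball (b i) (1 / 2)) := by
    intro i j hij
    refine Metric.ball_disjoint_ball ?_
    have h1 : ‖b i - b j‖ ^ 2 = 2 := by
      rw [@norm_sub_sq ℂ, b.orthonormal.1, b.orthonormal.1, b.orthonormal.2 hij]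
      norm_num
    rw [dist_eq_norm]
    nlinarith [norm_nonneg (b i - b j)]
  exact h.countable_of_isOpen_disjoint (fun _ => Metric.isOpen_ball)
    fun i => Metric.nonempty_ball.2 (by norm_num)

/-- `L` is the mean `∫ Φ(v) ⊗ Φ(v) dμ(v)` of the rank one operators of a bounded measurable
family `Φ`. -/
structure IsMeanRankOne (L : H →L[ℂ] H) (μ : Measure V) (Φ : V → H) (κ : ℝ) : Prop where
  stronglyMeasurable : StronglyMeasurable Φ
  norm_le : ∀ v, ‖Φ v‖ ≤ κ
  inner_eq : ∀ h r, ⟪h, L r⟫_ℂ = ∫ v, ⟪h, Φ v⟫_ℂ * ⟪Φ v, r⟫_ℂ ∂μ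

variable {L : H →L[ℂ] H} {μ : Measure V} {Φ : V → H} {κ : ℝ}

theorem IsMeanRankOne.norm_inner_mul_inner_le (hΦ : IsMeanRankOne L μ Φ κ) (h r : H) (v : V) :
    ‖⟪h, Φ v⟫_ℂ * ⟪Φ v, r⟫_ℂ‖ ≤ κ ^ 2 * (‖h‖ * ‖r‖) := by
  have h1 : ‖⟪h, Φ v⟫_ℂ‖ ≤ ‖h‖ * κ :=
    (norm_inner_le_norm _ _).trans (by gcongr; exact hΦ.norm_le v)
  have h2 : ‖⟪Φ v, r⟫_ℂ‖ ≤ κ * ‖r‖ :=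
    (norm_inner_le_norm _ _).trans (by gcongr; exact hΦ.norm_le v)
  rw [norm_mul]
  refine (mul_le_mul h1 h2 (norm_nonneg _) ((norm_nonneg _).trans h1)).trans (le_of_eq (by ring))

theorem IsMeanRankOne.inner_self_eq (hΦ : IsMeanRankOne L μ Φ κ) (h : H) :
    ⟪h, L h⟫_ℂ = ((∫ v, ‖⟪h, Φ v⟫_ℂ‖ ^ 2 ∂μ : ℝ) : ℂ) := by
  rw [hΦ.inner_eq, ← integral_complex_ofReal]
  refine integral_congr_ae (.of_forall fun v => ?_)
  simp only
  rw [← inner_conj_symm (Φ v) h, Complex.mul_conj, Complex.normSq_eq_norm_sq]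

theorem IsMeanRankOne.nonneg (hΦ : IsMeanRankOne L μ Φ κ) : 0 ≤ L := by
  rw [ContinuousLinearMap.nonneg_iff_isPositive, ContinuousLinearMap.isPositive_iff_complex]
  intro x
  have h := hΦ.inner_self_eq x
  have h2 : ⟪L x, x⟫_ℂ = ((∫ v, ‖⟪x, Φ v⟫_ℂ‖ ^ 2 ∂μ : ℝ) : ℂ) := by
    rw [← inner_conj_symm, h, Complex.conj_ofReal]
  rw [h2]
  exact ⟨by simp, by simpa using integral_nonneg fun v => by positivity⟩

variable [IsProbabilityMeasure μ]

theorem IsMeanRankOne.integrable (hΦ : IsMeanRankOne L μ Φ κ) (h r : H) :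
    Integrable (fun v => ⟪h, Φ v⟫_ℂ * ⟪Φ v, r⟫_ℂ) μ :=
  .of_bound ((stronglyMeasurable_const.inner hΦ.stronglyMeasurable).mul
    (hΦ.stronglyMeasurable.inner stronglyMeasurable_const)).aestronglyMeasurable _
    (.of_forall (hΦ.norm_inner_mul_inner_le h r))

theorem IsMeanRankOne.norm_le_sq (hΦ : IsMeanRankOne L μ Φ κ) : ‖L‖ ≤ κ ^ 2 := by
  refine ContinuousLinearMap.opNorm_le_bound _ (sq_nonneg κ) fun r => ?_
  have h : ‖L r‖ ^ 2 ≤ κ ^ 2 * (‖L r‖ * ‖r‖) := by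
    have h1 : ‖⟪L r, L r⟫_ℂ‖ = ‖L r‖ ^ 2 := by
      rw [inner_self_eq_norm_sq_to_K]; simp
    rw [← h1, hΦ.inner_eq]
    simpa using norm_integral_le_of_norm_le_const (μ := μ)
      (.of_forall (hΦ.norm_inner_mul_inner_le (L r) r))
  rcases (norm_nonneg (L r)).eq_or_lt with h0 | h0
  · rw [← h0]; positivity
  · nlinarith

variable [CompleteSpace H]

/-- Parseval for `S (Φ v)`, then Tonelli: the `i`-th coefficient integrates to `⟪S eᵢ, L (S eᵢ)⟫`.
-/
theorem IsMeanRankOne.lintegral_norm_apply_sq [TopologicalSpace.SeparableSpace H]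
    (hΦ : IsMeanRankOne L μ Φ κ) {S : H →L[ℂ] H} (hS : IsSelfAdjoint S) :
    ∫⁻ v, ENNReal.ofReal (‖S (Φ v)‖ ^ 2) ∂μ = opTrace (S * L * S) := by
  have : Countable (exists_hilbertBasis ℂ H).choose :=
    (hilbertBasis H).countable_of_separableSpace
  have hadj : ∀ x y, ⟪x, S y⟫_ℂ = ⟪S x, y⟫_ℂ := fun x y => by
    rw [← ContinuousLinearMap.adjoint_inner_left, hS.adjoint_eq]
  have h1 : ∀ v, ENNReal.ofReal (‖S (Φ v)‖ ^ 2) =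
      ∑' i, ENNReal.ofReal (‖⟪S (hilbertBasis H i), Φ v⟫_ℂ‖ ^ 2) := by
    intro v
    have h2 := (hilbertBasis H).hasSum_inner_mul_inner (S (Φ v)) (S (Φ v))
    have h3 : HasSum (fun i => ‖⟪S (hilbertBasis H i), Φ v⟫_ℂ‖ ^ 2) (‖S (Φ v)‖ ^ 2) := by
      rw [← Complex.hasSum_ofReal]
      have h4 : ⟪S (Φ v), S (Φ v)⟫_ℂ = ((‖S (Φ v)‖ ^ 2 : ℝ) : ℂ) := by
        rw [inner_self_eq_norm_sq_to_K]; simp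
      rw [← h4]
      refine h2.congr_fun fun i => ?_
      rw [← inner_conj_symm (S (Φ v)), hadj, mul_comm, Complex.mul_conj, Complex.normSq_eq_norm_sq]
    rw [← h3.tsum_eq, ENNReal.ofReal_tsum_of_nonneg (fun _ => by positivity) h3.summable]
  simp_rw [h1]
  rw [lintegral_tsum, opTrace]
  · refine tsum_congr fun i => ?_
    rw [mul_apply_eq_comp, mul_apply_eq_comp, hadj, hΦ.inner_self_eq,
      Complex.ofReal_re, ofReal_integral_eq_lintegral_ofReal]
    · have h4 := hΦ.integrable (S (hilbertBasis H i)) (S (hilbertBasis H i))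
      refine h4.norm.congr (.of_forall fun v => ?_)
      simp only
      rw [norm_mul, norm_inner_symm (Φ v), sq]
    · exact .of_forall fun v => by positivity
  · intro i
    exact ((stronglyMeasurable_const.inner hΦ.stronglyMeasurable).norm.pow
      2).measurable.ennreal_ofReal.aemeasurable

theorem IsMeanRankOne.lintegral_one_sub_smul_pow_le [TopologicalSpace.SeparableSpace H]
    (hΦ : IsMeanRankOne L μ Φ κ) {eta lam : ℝ} (heta : 0 < eta) (hetaM : eta * κ ^ 2 ≤ 1)
    (hlam : 0 < lam) {k : ℕ} (hk : 0 < k) :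
    ∫⁻ v, ENNReal.ofReal (‖((1 - (eta : ℂ) • L) ^ k) (Φ v)‖ ^ 2) ∂μ ≤
      ENNReal.ofReal ((eta * (2 * k : ℕ))⁻¹ + lam) * effectiveDimension L lam := by
  have hL := hΦ.nonneg
  rw [effectiveDimension, ← resolventSqrt_mul_mul_resolventSqrt hL hlam,
    ← hΦ.lintegral_norm_apply_sq (isSelfAdjoint_resolventSqrt L lam),
    ← lintegral_const_mul' _ _ ENNReal.ofReal_ne_top]
  refine lintegral_mono fun v => ?_
  rw [← ENNReal.ofReal_mul (by positivity)]
  exact ENNReal.ofReal_le_ofReal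
    (norm_one_sub_smul_pow_apply_le hL hΦ.norm_le_sq heta hetaM hlam hk (Φ v))

end RandomRankOne

/-- By second countability every open set is a countable union of balls, whose preimages are
controlled by the distance functions. -/
theorem measurable_of_forall_measurable_edist {A E : Type*} [MeasurableSpace A]
    [PseudoEMetricSpace E] [SecondCountableTopology E] [MeasurableSpace E] [BorelSpace E]
    {f : A → E} (h : ∀ e, Measurable fun a => edist (f a) e) : Measurable f := by
  refine measurable_of_isOpen fun U hU => ?_
  choose! r hr hrU using fun x (hx : x ∈ U) => EMetric.isOpen_iff.1 hU x hx
  obtain ⟨t, htU, htc, ht⟩ := TopologicalSpace.countable_cover_nhdsWithin (s := U)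
    (f := fun x => Metric.eball x (r x))
    fun x hx => mem_nhdsWithin_of_mem_nhds (Metric.eball_mem_nhds x (hr x hx))
  have hUt : U = ⋃ x ∈ t, Metric.eball x (r x) :=
    ht.antisymm (Set.iUnion₂_subset fun x hx => hrU x (htU hx))
  rw [hUt, Set.preimage_iUnion₂]
  exact .biUnion htc fun x _ => measurableSet_lt (h x) measurable_const

/-! ### Real functions as vectors of the complexified `L²`. -/

section ToL2

variable {X : Type*} [MeasurableSpace X] {ν : Measure X}

open Classical in
/-- The element of the complexified `L²(ν)` given by a real function; `0` if the function is not
square integrable. -/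
def toL2 (ν : Measure X) (f : X → ℝ) : Lp ℂ 2 ν :=
  if h : MemLp (fun x => (f x : ℂ)) 2 ν then h.toLp else 0

theorem coeFn_toL2 {f : X → ℝ} (hf : MemLp f 2 ν) : toL2 ν f =ᵐ[ν] fun x => (f x : ℂ) := by
  have h : MemLp (fun x => (f x : ℂ)) 2 ν := hf.ofReal
  rw [toL2, dif_pos h]
  exact h.coeFn_toLp

theorem eq_toL2 {f : X → ℝ} (hf : MemLp f 2 ν) {g : Lp ℂ 2 ν} (h : g =ᵐ[ν] fun x => (f x : ℂ)) :
    g = toL2 ν f :=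
  Lp.ext (h.trans (coeFn_toL2 hf).symm)

theorem toL2_zero : toL2 ν (fun _ => 0) = 0 := by
  refine (eq_toL2 (f := fun _ => 0) (MemLp.zero' ) ?_).symm
  filter_upwards [Lp.coeFn_zero ℂ 2 ν] with x hx
  simpa using hx

theorem toL2_sub {f g : X → ℝ} (hf : MemLp f 2 ν) (hg : MemLp g 2 ν) :
    toL2 ν (fun x => f x - g x) = toL2 ν f - toL2 ν g := by
  refine (eq_toL2 (hf.sub hg) ?_).symm
  filter_upwards [Lp.coeFn_sub (toL2 ν f) (toL2 ν g), coeFn_toL2 hf, coeFn_toL2 hg] with x h h1 h2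
  rw [h, Pi.sub_apply, h1, h2, Pi.sub_apply, Complex.ofReal_sub]

theorem toL2_const_mul {f : X → ℝ} (c : ℝ) (hf : MemLp f 2 ν) :
    toL2 ν (fun x => c * f x) = (c : ℂ) • toL2 ν f := by
  refine (eq_toL2 (hf.const_mul c) ?_).symm
  filter_upwards [Lp.coeFn_smul (c : ℂ) (toL2 ν f), coeFn_toL2 hf] with x h h1
  rw [h, Pi.smul_apply, h1]
  push_cast
  rfl

theorem enorm_toL2 {f : X → ℝ} (hf : MemLp f 2 ν) : ‖toL2 ν f‖ₑ = eLpNorm f 2 ν := by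
  rw [Lp.enorm_def, eLpNorm_congr_ae (coeFn_toL2 hf)]
  exact eLpNorm_congr_norm_ae (.of_forall fun x => Complex.norm_real _)

theorem norm_toL2_sq {f : X → ℝ} (hf : MemLp f 2 ν) : ‖toL2 ν f‖ ^ 2 = ∫ x, f x ^ 2 ∂ν := by
  have h : ((‖toL2 ν f‖ ^ 2 : ℝ) : ℂ) = ((∫ x, f x ^ 2 ∂ν : ℝ) : ℂ) := by
    have h1 : ⟪toL2 ν f, toL2 ν f⟫_ℂ = ((‖toL2 ν f‖ ^ 2 : ℝ) : ℂ) := by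
      rw [inner_self_eq_norm_sq_to_K]; simp
    rw [← h1, L2.inner_def, ← integral_complex_ofReal]
    refine integral_congr_ae ?_
    filter_upwards [coeFn_toL2 hf] with x hx
    simp [hx, sq, ← Complex.ofReal_mul]
  exact_mod_cast h

theorem inner_toL2_left {f : X → ℝ} (hf : MemLp f 2 ν) (h : Lp ℂ 2 ν) :
    ⟪toL2 ν f, h⟫_ℂ = ∫ x, (f x : ℂ) * h x ∂ν := by
  rw [L2.inner_def]
  refine integral_congr_ae ?_
  filter_upwards [coeFn_toL2 hf] with x hx
  simp [hx, mul_comm]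

theorem inner_toL2_right {f : X → ℝ} (hf : MemLp f 2 ν) (h : Lp ℂ 2 ν) :
    ⟪h, toL2 ν f⟫_ℂ = ∫ x, (starRingEnd ℂ) (h x) * (f x : ℂ) ∂ν := by
  rw [L2.inner_def]
  refine integral_congr_ae ?_
  filter_upwards [coeFn_toL2 hf] with x hx
  simp [hx, mul_comm]

theorem inner_toL2_toL2 {f g : X → ℝ} (hf : MemLp f 2 ν) (hg : MemLp g 2 ν) :
    ⟪toL2 ν f, toL2 ν g⟫_ℂ = ((∫ x, f x * g x ∂ν : ℝ) : ℂ) := by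
  rw [inner_toL2_left hf, ← integral_complex_ofReal]
  refine integral_congr_ae ?_
  filter_upwards [coeFn_toL2 hg] with x hx
  simp [hx]

/-- The distance from `toL2 ν (f a)` to a fixed vector is an integral depending on the parameter
`a`, hence measurable in `a`; separability of `L²` then suffices. -/
theorem stronglyMeasurable_toL2 [MeasurableSpace.CountablyGenerated X] [SFinite ν]
    {A : Type*} [MeasurableSpace A] {f : A → X → ℝ}
    (hf : Measurable fun p : A × X => f p.1 p.2) (hf2 : ∀ a, MemLp (f a) 2 ν) :
    StronglyMeasurable fun a => toL2 ν (f a) := by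
  have : Fact ((2 : ℝ≥0∞) ≠ ∞) := ⟨by norm_num⟩
  borelize ↥(Lp ℂ 2 ν)
  refine Measurable.stronglyMeasurable (measurable_of_forall_measurable_edist fun g => ?_)
  have h1 : ∀ a, edist (toL2 ν (f a)) g = (∫⁻ x, ‖(f a x : ℂ) - g x‖ₑ ^ 2 ∂ν) ^ (1 / 2 : ℝ) := by
    intro a
    rw [Lp.edist_def, eLpNorm_eq_lintegral_rpow_enorm_toReal (by norm_num) (by norm_num)]
    simp only [ENNReal.toReal_ofNat, ENNReal.rpow_ofNat, Pi.sub_apply]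
    congr 1
    refine lintegral_congr_ae ?_
    filter_upwards [coeFn_toL2 (hf2 a)] with x hx
    rw [hx]
  simp_rw [h1]
  refine Measurable.pow_const ?_ _
  have h2 : Measurable fun p : A × X => ‖(f p.1 p.2 : ℂ) - g p.2‖ₑ ^ 2 :=
    (((Complex.measurable_ofReal.comp hf).sub
      ((Lp.stronglyMeasurable g).measurable.comp measurable_snd)).enorm).pow_const 2
  exact h2.lintegral_prod_right'

end ToL2

/-! ### The integral operator as the mean of rank one operators of features. -/

section Features

variable {X : Type*} [MeasurableSpace X] {V : Type*} [MeasurableSpace V]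

/-- A jointly measurable feature, each section of which is bounded by `κ` almost everywhere. -/
structure IsBoundedFeature (φ : V → X → ℝ) (ν : Measure X) (κ : ℝ) : Prop where
  measurable : Measurable fun p : V × X => φ p.1 p.2
  abs_le : ∀ v, ∀ᵐ x ∂ν, |φ v x| ≤ κ

variable {φ : V → X → ℝ} {ν : Measure X} {κ : ℝ} [IsProbabilityMeasure ν]

theorem IsBoundedFeature.memLp (hφ : IsBoundedFeature φ ν κ) (v : V) : MemLp (φ v) 2 ν :=
  .of_bound (hφ.measurable.of_uncurry_left).aestronglyMeasurable κ (hφ.abs_le v)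

theorem IsBoundedFeature.nonneg (hφ : IsBoundedFeature φ ν κ) (v : V) : 0 ≤ κ := by
  obtain ⟨x, hx⟩ := (hφ.abs_le v).exists
  exact (abs_nonneg _).trans hx

theorem IsBoundedFeature.norm_toL2_le (hφ : IsBoundedFeature φ ν κ) (v : V) :
    ‖toL2 ν (φ v)‖ ≤ κ := by
  refine abs_le_of_sq_le_sq' ?_ (hφ.nonneg v) |>.2
  rw [norm_toL2_sq (hφ.memLp v)]
  calc ∫ x, φ v x ^ 2 ∂ν ≤ ∫ _, κ ^ 2 ∂ν := by
        refine integral_mono_ae (hφ.memLp v).integrable_sq (integrable_const _) ?_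
        filter_upwards [hφ.abs_le v] with x hx
        exact sq_le_sq' (_root_.abs_le.1 hx).1 (_root_.abs_le.1 hx).2
    _ = κ ^ 2 := by simp

variable {μ : Measure V} [IsProbabilityMeasure μ] {K : X → X → ℝ}

theorem IsBoundedFeature.integrable_triple (hφ : IsBoundedFeature φ ν κ) {h r : X → ℂ}
    (hh : Integrable h ν) (hr : Integrable r ν) :
    Integrable (fun p : (X × X) × V => h p.1.1 * (r p.1.2 * ((φ p.2 p.1.2 * φ p.2 p.1.1 : ℝ) : ℂ)))
      ((ν.prod ν).prod μ) := by
  have h1 : Integrable (fun p : (X × X) × V => h p.1.1 * r p.1.2) ((ν.prod ν).prod μ) :=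
    (hh.mul_prod hr).comp_fst μ
  have hm : Measurable fun p : (X × X) × V => ((φ p.2 p.1.2 * φ p.2 p.1.1 : ℝ) : ℂ) :=
    Complex.measurable_ofReal.comp
      ((hφ.measurable.comp (by fun_prop : Measurable fun p : (X × X) × V => (p.2, p.1.2))).mul
        (hφ.measurable.comp (by fun_prop : Measurable fun p : (X × X) × V => (p.2, p.1.1))))
  have hb : ∀ᵐ p ∂((ν.prod ν).prod μ), ‖((φ p.2 p.1.2 * φ p.2 p.1.1 : ℝ) : ℂ)‖ ≤ κ ^ 2 := by
    have hs : MeasurableSet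
        {p : (X × X) × V | ‖((φ p.2 p.1.2 * φ p.2 p.1.1 : ℝ) : ℂ)‖ ≤ κ ^ 2} :=
      measurableSet_le hm.norm measurable_const
    refine (Measure.ae_prod_mem_iff_ae_ae_mem hs).2 ?_
    have hs' : MeasurableSet
        {p : V × (X × X) | ‖((φ p.1 p.2.2 * φ p.1 p.2.1 : ℝ) : ℂ)‖ ≤ κ ^ 2} :=
      measurable_swap hs
    -- The bound on `φ` holds almost everywhere in `x` for each fixed `v`, so `v` has to be the
    -- outer variable.
    refine (Measure.ae_ae_comm hs).2 (.of_forall fun v => ?_)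
    filter_upwards [Measure.quasiMeasurePreserving_fst.ae (hφ.abs_le v),
      Measure.quasiMeasurePreserving_snd.ae (hφ.abs_le v)] with q h1 h2
    rw [Complex.norm_real, Real.norm_eq_abs, abs_mul, sq]
    exact mul_le_mul h2 h1 (abs_nonneg _) (hφ.nonneg v)
  refine (h1.mul_bdd hm.aestronglyMeasurable hb).congr (.of_forall fun p => ?_)
  simp only [mul_assoc]

/-- Insert the integral formula for `K` and move the integral over `v` outside by Fubini; for fixed
`v` the double integral over `x, x'` factorizes. -/
theorem IsBoundedFeature.isMeanRankOne [MeasurableSpace.CountablyGenerated X]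
    (hφ : IsBoundedFeature φ ν κ) (hK : KernelMemL2 K ν)
    (hKφ : ∀ x x', K x x' = ∫ v, φ v x * φ v x' ∂μ) :
    IsMeanRankOne (integralOperator K ν) μ (fun v => toL2 ν (φ v)) κ where
  stronglyMeasurable := stronglyMeasurable_toL2 hφ.measurable hφ.memLp
  norm_le := hφ.norm_toL2_le
  inner_eq h r := by
    have hh : Integrable (fun x => (starRingEnd ℂ) (h x)) ν :=
      (Lp.memLp h).star.integrable (by norm_num)
    have hr : Integrable (fun x => r x) ν := (Lp.memLp r).integrable (by norm_num)
    have h3 := hφ.integrable_triple (μ := μ) hh hr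
    calc ⟪h, integralOperator K ν r⟫_ℂ
        = ∫ x', (starRingEnd ℂ) (h x') * ∫ x, r x * (K x x' : ℂ) ∂ν ∂ν := by
          rw [L2.inner_def]
          refine integral_congr_ae ?_
          filter_upwards [coeFn_integralOperator hK r] with x hx
          simp [hx, mul_comm]
      _ = ∫ x', ∫ x, ∫ v, (starRingEnd ℂ) (h x') * (r x * ((φ v x * φ v x' : ℝ) : ℂ)) ∂μ ∂ν ∂ν := by
          congr 1 with x'
          rw [← integral_const_mul]
          congr 1 with x
          rw [integral_const_mul, integral_const_mul, integral_complex_ofReal, hKφ]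
      _ = ∫ q, ∫ v, (starRingEnd ℂ) (h q.1) * (r q.2 * ((φ v q.2 * φ v q.1 : ℝ) : ℂ)) ∂μ
            ∂(ν.prod ν) := (integral_prod _ h3.integral_prod_left).symm
      _ = ∫ v, ∫ q, (starRingEnd ℂ) (h q.1) * (r q.2 * ((φ v q.2 * φ v q.1 : ℝ) : ℂ)) ∂(ν.prod ν)
            ∂μ := integral_integral_swap h3
      _ = ∫ v, ⟪h, toL2 ν (φ v)⟫_ℂ * ⟪toL2 ν (φ v), r⟫_ℂ ∂μ := by
          congr 1 with v
          rw [inner_toL2_right (hφ.memLp v), inner_toL2_left (hφ.memLp v), ← integral_prod_mul]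
          congr 1 with q
          push_cast
          ring

end Features

/-! ### The regression function and the decomposition of the risk. -/

section Regression

variable {X : Type*} [MeasurableSpace X] {ρ : Measure (X × ℝ)}

theorem memLp_comp_fst {f : X → ℝ} (hf : MemLp f 2 ρ.fst) : MemLp (fun z : X × ℝ => f z.1) 2 ρ :=
  hf.comp_measurePreserving ⟨measurable_fst, rfl⟩

theorem memLp_snd (hy : Integrable (fun z : X × ℝ => z.2 ^ 2) ρ) :
    MemLp (fun z : X × ℝ => z.2) 2 ρ :=
  (memLp_two_iff_integrable_sq measurable_snd.aestronglyMeasurable).2 hy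

theorem integral_comp_fst (f : X → ℝ) (hf : AEStronglyMeasurable f ρ.fst) :
    ∫ z, f z.1 ∂ρ = ∫ x, f x ∂ρ.fst :=
  (integral_map measurable_fst.aemeasurable hf).symm

variable [IsProbabilityMeasure ρ]

theorem integral_mul_snd (hy : Integrable (fun z : X × ℝ => z.2 ^ 2) ρ) {h : X → ℝ}
    (hh : MemLp h 2 ρ.fst) :
    ∫ z, h z.1 * z.2 ∂ρ = ∫ x, h x * regressionFunction ρ x ∂ρ.fst := by
  have h1 : Integrable (fun z : X × ℝ => h z.1 * z.2) ρ :=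
    (memLp_comp_fst hh).integrable_mul (memLp_snd hy)
  rw [← ρ.integral_condKernel h1]
  congr 1 with x
  exact integral_const_mul (h x) fun y : ℝ => y

theorem integral_mul_sub_snd (hy : Integrable (fun z : X × ℝ => z.2 ^ 2) ρ)
    (hρ : MemLp (regressionFunction ρ) 2 ρ.fst) {h f : X → ℝ}
    (hh : MemLp h 2 ρ.fst) (hf : MemLp f 2 ρ.fst) :
    ∫ z, h z.1 * (f z.1 - z.2) ∂ρ = ∫ x, h x * (f x - regressionFunction ρ x) ∂ρ.fst := by
  have h1 : Integrable (fun z : X × ℝ => h z.1 * f z.1) ρ :=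
    (memLp_comp_fst hh).integrable_mul (memLp_comp_fst hf)
  have h2 : Integrable (fun z : X × ℝ => h z.1 * z.2) ρ :=
    (memLp_comp_fst hh).integrable_mul (memLp_snd hy)
  have h3 : Integrable (fun x => h x * f x) ρ.fst := hh.integrable_mul hf
  have h4 : Integrable (fun x => h x * regressionFunction ρ x) ρ.fst := hh.integrable_mul hρ
  simp_rw [mul_sub]
  rw [integral_sub h1 h2, integral_mul_snd hy hh, integral_sub h3 h4,
    integral_comp_fst (fun x => h x * f x) h3.1]

/-- Pythagoras: `f_ρ(x) - y` is orthogonal in `L²(ρ)` to square integrable functions of `x` alone,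
so the cross term `h0` vanishes. -/
theorem expectedRisk_eq (hy : Integrable (fun z : X × ℝ => z.2 ^ 2) ρ)
    (hρ : MemLp (regressionFunction ρ) 2 ρ.fst) {f : X → ℝ} (hf : MemLp f 2 ρ.fst) :
    expectedRisk ρ f = ‖toL2 ρ.fst f - toL2 ρ.fst (regressionFunction ρ)‖ ^ 2 +
      expectedRisk ρ (regressionFunction ρ) := by
  have hd : MemLp (fun x => f x - regressionFunction ρ x) 2 ρ.fst := hf.sub hρ
  have h0 := integral_mul_sub_snd hy hρ hd hρ
  simp only [sub_self, mul_zero, integral_zero] at h0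
  have h1 : MemLp (fun z : X × ℝ => regressionFunction ρ z.1 - z.2) 2 ρ :=
    (memLp_comp_fst hρ).sub (memLp_snd hy)
  have h2 : Integrable (fun z : X × ℝ =>
      (f z.1 - regressionFunction ρ z.1) * (regressionFunction ρ z.1 - z.2)) ρ :=
    (memLp_comp_fst hd).integrable_mul h1
  have h3 : Integrable (fun z : X × ℝ => (f z.1 - regressionFunction ρ z.1) ^ 2) ρ :=
    (memLp_comp_fst hd).integrable_sq
  have h4 : Integrable (fun z : X × ℝ => (regressionFunction ρ z.1 - z.2) ^ 2) ρ :=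
    h1.integrable_sq
  rw [← toL2_sub hf hρ, norm_toL2_sq hd, expectedRisk, expectedRisk,
    ← integral_comp_fst (fun x => (f x - regressionFunction ρ x) ^ 2) (hd.1.pow 2)]
  have h5 : ∀ z : X × ℝ, (f z.1 - z.2) ^ 2 = (f z.1 - regressionFunction ρ z.1) ^ 2 +
      (regressionFunction ρ z.1 - z.2) ^ 2 +
      2 * ((f z.1 - regressionFunction ρ z.1) * (regressionFunction ρ z.1 - z.2)) :=
    fun z => by ring
  simp_rw [h5]
  refine (integral_add (h3.add h4) (h2.const_mul 2)).trans ?_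
  rw [integral_const_mul, h0, mul_zero, add_zero]
  exact integral_add h3 h4

end Regression

/-! ### One step of the algorithm, in mean square. -/

section OneStep

variable {X : Type*} [MeasurableSpace X]
  {V : Type*} [MeasurableSpace V]
  {ρ : Measure (X × ℝ)} {μ : Measure V} {φ : V → X → ℝ} {κ : ℝ}

theorem norm_sub_smul_sq {H : Type*} [NormedAddCommGroup H] [InnerProductSpace ℂ H]
    (a b : H) (c : ℝ) :
    ‖a - (c : ℂ) • b‖ ^ 2 = ‖a‖ ^ 2 - 2 * (c * (⟪a, b⟫_ℂ).re) + c ^ 2 * ‖b‖ ^ 2 := by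
  rw [@norm_sub_sq ℂ, inner_smul_right, norm_smul, mul_pow, Complex.norm_real, Real.norm_eq_abs,
    sq_abs]
  simp

theorem IsBoundedFeature.measurable_comp_sample (hφ : IsBoundedFeature φ ρ.fst κ) :
    Measurable fun s : (X × ℝ) × V => φ s.2 s.1.1 :=
  hφ.measurable.comp (by fun_prop : Measurable fun s : (X × ℝ) × V => (s.2, s.1.1))

variable [IsProbabilityMeasure ρ] [IsProbabilityMeasure μ]

theorem IsBoundedFeature.ae_abs_comp_sample_le (hφ : IsBoundedFeature φ ρ.fst κ) :
    ∀ᵐ s ∂(ρ.prod μ), |φ s.2 s.1.1| ≤ κ := by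
  have hs : MeasurableSet {s : (X × ℝ) × V | |φ s.2 s.1.1| ≤ κ} :=
    measurableSet_le hφ.measurable_comp_sample.abs measurable_const
  refine (Measure.ae_prod_mem_iff_ae_ae_mem hs).2 ?_
  refine (Measure.ae_ae_comm hs).2 (.of_forall fun v => ?_)
  have : Measure.QuasiMeasurePreserving Prod.fst ρ ρ.fst :=
    (⟨measurable_fst, rfl⟩ : MeasurePreserving Prod.fst ρ ρ.fst).quasiMeasurePreserving
  exact this.ae (hφ.abs_le v)

theorem IsBoundedFeature.memLp_residual_mul (hφ : IsBoundedFeature φ ρ.fst κ)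
    (hy : Integrable (fun z : X × ℝ => z.2 ^ 2) ρ) {f : X → ℝ} (hf : MemLp f 2 ρ.fst) :
    MemLp (fun s : (X × ℝ) × V => (f s.1.1 - s.1.2) * φ s.2 s.1.1) 2 (ρ.prod μ) := by
  have h1 : MemLp (fun s : (X × ℝ) × V => f s.1.1 - s.1.2) 2 (ρ.prod μ) :=
    ((memLp_comp_fst hf).sub (memLp_snd hy)).comp_fst μ
  refine MemLp.of_le_mul (c := κ) h1
    (h1.1.mul hφ.measurable_comp_sample.aestronglyMeasurable) ?_
  filter_upwards [hφ.ae_abs_comp_sample_le] with s hs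
  rw [norm_mul, mul_comm]
  exact mul_le_mul_of_nonneg_right hs (norm_nonneg _)

theorem IsBoundedFeature.sq_residual_mul_le (hφ : IsBoundedFeature φ ρ.fst κ) (f : X → ℝ) :
    ∀ᵐ s ∂(ρ.prod μ), ((f s.1.1 - s.1.2) * φ s.2 s.1.1) ^ 2 ≤ κ ^ 2 * (f s.1.1 - s.1.2) ^ 2 := by
  filter_upwards [hφ.ae_abs_comp_sample_le] with s hs
  rw [mul_pow, mul_comm]
  exact mul_le_mul_of_nonneg_right (sq_le_sq' (_root_.abs_le.1 hs).1 (_root_.abs_le.1 hs).2)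
    (sq_nonneg _)

/-- The stochastic gradient has mean `L (f - f_ρ)`: integrating over `z` for fixed `v` replaces `y`
by `f_ρ`, and integrating over `v` produces `L`. -/
theorem IsBoundedFeature.integral_residual_mul_inner (hφ : IsBoundedFeature φ ρ.fst κ)
    (hy : Integrable (fun z : X × ℝ => z.2 ^ 2) ρ) (hρ : MemLp (regressionFunction ρ) 2 ρ.fst)
    {L : Lp ℂ 2 ρ.fst →L[ℂ] Lp ℂ 2 ρ.fst}
    (hL : IsMeanRankOne L μ (fun v => toL2 ρ.fst (φ v)) κ) {f : X → ℝ} (hf : MemLp f 2 ρ.fst)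
    (b : Lp ℂ 2 ρ.fst) :
    Integrable (fun s : (X × ℝ) × V =>
        (f s.1.1 - s.1.2) * φ s.2 s.1.1 * (⟪b, toL2 ρ.fst (φ s.2)⟫_ℂ).re) (ρ.prod μ) ∧
      ∫ s, (f s.1.1 - s.1.2) * φ s.2 s.1.1 * (⟪b, toL2 ρ.fst (φ s.2)⟫_ℂ).re ∂(ρ.prod μ) =
        (⟪b, L (toL2 ρ.fst f - toL2 ρ.fst (regressionFunction ρ))⟫_ℂ).re := by
  have hm : Measurable fun v => (⟪b, toL2 ρ.fst (φ v)⟫_ℂ).re :=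
    Complex.measurable_re.comp (stronglyMeasurable_const.inner hL.stronglyMeasurable).measurable
  have hint : Integrable (fun s : (X × ℝ) × V =>
      (f s.1.1 - s.1.2) * φ s.2 s.1.1 * (⟪b, toL2 ρ.fst (φ s.2)⟫_ℂ).re) (ρ.prod μ) := by
    refine ((hφ.memLp_residual_mul hy hf).integrable (by norm_num)).mul_bdd (c := ‖b‖ * κ)
      (hm.comp measurable_snd).aestronglyMeasurable (.of_forall fun s => ?_)
    calc ‖(⟪b, toL2 ρ.fst (φ s.2)⟫_ℂ).re‖ ≤ ‖⟪b, toL2 ρ.fst (φ s.2)⟫_ℂ‖ := Complex.abs_re_le_norm _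
      _ ≤ ‖b‖ * ‖toL2 ρ.fst (φ s.2)‖ := norm_inner_le_norm _ _
      _ ≤ ‖b‖ * κ := by gcongr; exact hL.norm_le s.2
  refine ⟨hint, ?_⟩
  have hfρ : MemLp (fun x => f x - regressionFunction ρ x) 2 ρ.fst := hf.sub hρ
  have h1 : ∀ v, ∫ z, (f z.1 - z.2) * φ v z.1 * (⟪b, toL2 ρ.fst (φ v)⟫_ℂ).re ∂ρ =
      (⟪b, toL2 ρ.fst (φ v)⟫_ℂ *
        ⟪toL2 ρ.fst (φ v), toL2 ρ.fst f - toL2 ρ.fst (regressionFunction ρ)⟫_ℂ).re := by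
    intro v
    rw [← toL2_sub hf hρ, inner_toL2_toL2 (hφ.memLp v) hfρ, Complex.re_mul_ofReal,
      ← integral_mul_sub_snd hy hρ (hφ.memLp v) hf, ← integral_const_mul]
    congr 1 with z
    ring
  rw [integral_prod_symm _ hint, hL.inner_eq]
  simp_rw [h1]
  exact integral_re (𝕜 := ℂ) (hL.integrable b _)

/-- Bounding `φ_v(x)²` by `κ²` leaves a function of `z` times a function of `v`, which are
independent. -/
theorem IsBoundedFeature.integral_residual_mul_norm_sq_le (hφ : IsBoundedFeature φ ρ.fst κ)
    (hy : Integrable (fun z : X × ℝ => z.2 ^ 2) ρ)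
    {L : Lp ℂ 2 ρ.fst →L[ℂ] Lp ℂ 2 ρ.fst}
    (hL : IsMeanRankOne L μ (fun v => toL2 ρ.fst (φ v)) κ) {f : X → ℝ} (hf : MemLp f 2 ρ.fst)
    (B : Lp ℂ 2 ρ.fst →L[ℂ] Lp ℂ 2 ρ.fst) :
    Integrable (fun s : (X × ℝ) × V =>
        ((f s.1.1 - s.1.2) * φ s.2 s.1.1) ^ 2 * ‖B (toL2 ρ.fst (φ s.2))‖ ^ 2) (ρ.prod μ) ∧
      ∫ s, ((f s.1.1 - s.1.2) * φ s.2 s.1.1) ^ 2 * ‖B (toL2 ρ.fst (φ s.2))‖ ^ 2 ∂(ρ.prod μ) ≤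
        κ ^ 2 * expectedRisk ρ f * ∫ v, ‖B (toL2 ρ.fst (φ v))‖ ^ 2 ∂μ := by
  have hm : Measurable fun v => ‖B (toL2 ρ.fst (φ v))‖ ^ 2 :=
    ((B.continuous.comp_stronglyMeasurable hL.stronglyMeasurable).norm.pow 2).measurable
  have hb : ∀ v, ‖‖B (toL2 ρ.fst (φ v))‖ ^ 2‖ ≤ (‖B‖ * κ) ^ 2 := fun v => by
    rw [Real.norm_of_nonneg (by positivity)]
    gcongr
    exact (B.le_opNorm _).trans (by gcongr; exact hL.norm_le v)
  have h1 : Integrable (fun v => ‖B (toL2 ρ.fst (φ v))‖ ^ 2) μ :=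
    .of_bound hm.aestronglyMeasurable _ (.of_forall hb)
  have h2 : Integrable (fun z : X × ℝ => κ ^ 2 * (f z.1 - z.2) ^ 2) ρ :=
    ((memLp_comp_fst hf).sub (memLp_snd hy)).integrable_sq.const_mul _
  have hint : Integrable (fun s : (X × ℝ) × V =>
      ((f s.1.1 - s.1.2) * φ s.2 s.1.1) ^ 2 * ‖B (toL2 ρ.fst (φ s.2))‖ ^ 2) (ρ.prod μ) :=
    (hφ.memLp_residual_mul hy hf).integrable_sq.mul_bdd
      (hm.comp measurable_snd).aestronglyMeasurable (.of_forall fun s => hb s.2)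
  refine ⟨hint, ?_⟩
  have h3 : κ ^ 2 * expectedRisk ρ f = ∫ z, κ ^ 2 * (f z.1 - z.2) ^ 2 ∂ρ :=
    (integral_const_mul _ _).symm
  rw [h3, ← integral_prod_mul (fun z : X × ℝ => κ ^ 2 * (f z.1 - z.2) ^ 2)]
  refine integral_mono_ae hint (h2.mul_prod h1) ?_
  filter_upwards [hφ.sq_residual_mul_le f] with s hs
  exact mul_le_mul_of_nonneg_right hs (by positivity)

/-- The operator `B` is kept arbitrary so that powers of `1 - eta L` can be carried along; the noise
depends on `f` only through its risk, that is, through the error without `B`. -/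
theorem IsBoundedFeature.lintegral_norm_step_le (hφ : IsBoundedFeature φ ρ.fst κ)
    (hy : Integrable (fun z : X × ℝ => z.2 ^ 2) ρ) (hρ : MemLp (regressionFunction ρ) 2 ρ.fst)
    {L : Lp ℂ 2 ρ.fst →L[ℂ] Lp ℂ 2 ρ.fst}
    (hL : IsMeanRankOne L μ (fun v => toL2 ρ.fst (φ v)) κ) {f : X → ℝ} (hf : MemLp f 2 ρ.fst)
    (B : Lp ℂ 2 ρ.fst →L[ℂ] Lp ℂ 2 ρ.fst) (eta : ℝ) :
    ∫⁻ s, ENNReal.ofReal (‖B (toL2 ρ.fst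
        (fun x => f x - eta * ((f s.1.1 - s.1.2) * φ s.2 s.1.1) * φ s.2 x)
          - toL2 ρ.fst (regressionFunction ρ))‖ ^ 2) ∂(ρ.prod μ) ≤
      ENNReal.ofReal (‖B ((1 - (eta : ℂ) • L)
          (toL2 ρ.fst f - toL2 ρ.fst (regressionFunction ρ)))‖ ^ 2) +
        ENNReal.ofReal (eta ^ 2 * κ ^ 2) *
          (ENNReal.ofReal (‖toL2 ρ.fst f - toL2 ρ.fst (regressionFunction ρ)‖ ^ 2) +
            ENNReal.ofReal (expectedRisk ρ (regressionFunction ρ))) *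
          ∫⁻ v, ENNReal.ofReal (‖B (toL2 ρ.fst (φ v))‖ ^ 2) ∂μ := by
  set r := toL2 ρ.fst f - toL2 ρ.fst (regressionFunction ρ) with hr
  set a : (X × ℝ) × V → ℝ := fun s => (f s.1.1 - s.1.2) * φ s.2 s.1.1 with ha
  obtain ⟨hi1, he1⟩ := hφ.integral_residual_mul_inner hy hρ hL hf (B.adjoint (B r))
  obtain ⟨hi2, he2⟩ := hφ.integral_residual_mul_norm_sq_le hy hL hf B
  have hE0 : 0 ≤ expectedRisk ρ (regressionFunction ρ) :=
    integral_nonneg fun z => sq_nonneg _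
  have hsq : ∀ s : (X × ℝ) × V, ‖B (toL2 ρ.fst (fun x => f x - eta * a s * φ s.2 x)
      - toL2 ρ.fst (regressionFunction ρ))‖ ^ 2 = ‖B r‖ ^ 2 -
        2 * eta * (a s * (⟪B.adjoint (B r), toL2 ρ.fst (φ s.2)⟫_ℂ).re) +
        eta ^ 2 * (a s ^ 2 * ‖B (toL2 ρ.fst (φ s.2))‖ ^ 2) := by
    intro s
    rw [toL2_sub hf ((hφ.memLp s.2).const_mul (eta * a s)), toL2_const_mul _ (hφ.memLp s.2),
      sub_right_comm, ← hr, map_sub, map_smul, norm_sub_smul_sq,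
      ContinuousLinearMap.adjoint_inner_left]
    ring
  have hint : Integrable (fun s : (X × ℝ) × V => ‖B r‖ ^ 2 -
        2 * eta * (a s * (⟪B.adjoint (B r), toL2 ρ.fst (φ s.2)⟫_ℂ).re) +
        eta ^ 2 * (a s ^ 2 * ‖B (toL2 ρ.fst (φ s.2))‖ ^ 2)) (ρ.prod μ) :=
    ((integrable_const _).sub (hi1.const_mul _)).add (hi2.const_mul _)
  have hnn : ∀ s : (X × ℝ) × V, 0 ≤ ‖B r‖ ^ 2 -
        2 * eta * (a s * (⟪B.adjoint (B r), toL2 ρ.fst (φ s.2)⟫_ℂ).re) +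
        eta ^ 2 * (a s ^ 2 * ‖B (toL2 ρ.fst (φ s.2))‖ ^ 2) := fun s => by
    rw [← hsq]; positivity
  have hτ : Integrable (fun v => ‖B (toL2 ρ.fst (φ v))‖ ^ 2) μ := by
    refine .of_bound ((B.continuous.comp_stronglyMeasurable
      hL.stronglyMeasurable).norm.pow 2).aestronglyMeasurable ((‖B‖ * κ) ^ 2)
      (.of_forall fun v => ?_)
    rw [Real.norm_of_nonneg (by positivity)]
    gcongr
    exact (B.le_opNorm _).trans (by gcongr; exact hL.norm_le v)
  refine (lintegral_congr fun s => congrArg ENNReal.ofReal (hsq s)).trans_le ?_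
  rw [← ofReal_integral_eq_lintegral_ofReal hint (.of_forall hnn),
    ← ofReal_integral_eq_lintegral_ofReal hτ (.of_forall fun v => by positivity),
    ← ENNReal.ofReal_add (by positivity) hE0, ← ENNReal.ofReal_mul (by positivity),
    ← ENNReal.ofReal_mul (by positivity),
    ← ENNReal.ofReal_add (by positivity)
      (mul_nonneg (by positivity) (integral_nonneg fun v => by positivity))]
  refine ENNReal.ofReal_le_ofReal ?_
  rw [← expectedRisk_eq hy hρ hf]
  have hI : ∫ s, (‖B r‖ ^ 2 -
        2 * eta * (a s * (⟪B.adjoint (B r), toL2 ρ.fst (φ s.2)⟫_ℂ).re) +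
        eta ^ 2 * (a s ^ 2 * ‖B (toL2 ρ.fst (φ s.2))‖ ^ 2)) ∂(ρ.prod μ) =
      ‖B r‖ ^ 2 - 2 * eta * (⟪B.adjoint (B r), L r⟫_ℂ).re + eta ^ 2 *
        ∫ s, a s ^ 2 * ‖B (toL2 ρ.fst (φ s.2))‖ ^ 2 ∂(ρ.prod μ) := by
    refine (integral_add ((integrable_const _).sub (hi1.const_mul _)) (hi2.const_mul _)).trans ?_
    rw [integral_const_mul]
    congr 1
    refine (integral_sub (integrable_const _) (hi1.const_mul _)).trans ?_
    rw [integral_const_mul, he1, integral_const, probReal_univ, one_smul]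
  have hB : ‖B ((1 - (eta : ℂ) • L) r)‖ ^ 2 =
      ‖B r‖ ^ 2 - 2 * eta * (⟪B.adjoint (B r), L r⟫_ℂ).re + eta ^ 2 * ‖B (L r)‖ ^ 2 := by
    have : (1 - (eta : ℂ) • L) r = r - (eta : ℂ) • L r := rfl
    rw [this, map_sub, map_smul, norm_sub_smul_sq, ContinuousLinearMap.adjoint_inner_left]
    ring
  rw [hI, hB]
  have h3 := mul_le_mul_of_nonneg_left he2 (sq_nonneg eta)
  -- Adding this nonnegative term completes the square to `‖B ((1 - eta L) r)‖²`.
  have h4 : 0 ≤ eta ^ 2 * ‖B (L r)‖ ^ 2 := by positivity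
  linarith

end OneStep

/-- Extension of a finite sequence by a constant. -/
def extendFin {S : Type*} [Nonempty S] {t : ℕ} (p : Fin t → S) (n : ℕ) : S :=
  if h : n < t then p ⟨n, h⟩ else Classical.arbitrary S

theorem extendFin_snoc_last {S : Type*} [Nonempty S] {t : ℕ} (p : Fin t → S) (s : S) :
    extendFin (Fin.snoc p s : Fin (t + 1) → S) t = s := by
  simp [extendFin, Fin.snoc]

theorem extendFin_snoc_of_lt {S : Type*} [Nonempty S] {t n : ℕ} (p : Fin t → S) (s : S)
    (hn : n < t) : extendFin (Fin.snoc p s : Fin (t + 1) → S) n = extendFin p n := by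
  simp [extendFin, Fin.snoc, hn, hn.trans t.lt_succ_self]

theorem measurable_extendFin {S : Type*} [Nonempty S] [MeasurableSpace S] {t : ℕ} (n : ℕ) :
    Measurable fun p : Fin t → S => extendFin p n := by
  by_cases h : n < t
  · simpa [extendFin, h] using measurable_pi_apply _
  · simp [extendFin, h]

/-- The newest sample is integrated innermost, with the past, and hence the current iterate, held
fixed. -/
theorem lintegral_pi_fin_succ {S : Type*} [MeasurableSpace S] (π : Measure S) [SigmaFinite π]
    {t : ℕ} {G : (Fin (t + 1) → S) → ℝ≥0∞} (hG : Measurable G) :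
    ∫⁻ p, G p ∂(Measure.pi fun _ => π) =
      ∫⁻ p, ∫⁻ s, G (Fin.snoc p s) ∂π ∂(Measure.pi fun _ : Fin t => π) := by
  have h := measurePreserving_piFinSuccAbove (fun _ : Fin (t + 1) => π) (Fin.last t)
  have h1 := h.symm.lintegral_comp hG
  rw [← h1]
  refine (lintegral_prod_symm _ (hG.comp (MeasurableEquiv.measurable _)).aemeasurable).trans ?_
  refine lintegral_congr fun p => lintegral_congr fun s => ?_
  exact congrArg G (Fin.insertNth_last' s p)

/-! ### The iterates as measurable functions of finitely many samples. -/

section Iterate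

variable {X : Type*} {V : Type*}

/-- Only the first `t` samples matter, and features enter only through the functions `φ (v n)`; this
later permits changing `φ` on a null set of `v`. -/
theorem iterate_congr {φ φ' : V → X → ℝ} {η : ℕ → ℝ} {lam : ℝ}
    {z z' : ℕ → X × ℝ} {v v' : ℕ → V} {t : ℕ} (hz : ∀ n < t, z n = z' n)
    (hv : ∀ n < t, φ (v n) = φ' (v' n)) :
    iterate φ η lam z v t = iterate φ' η lam z' v' t := by
  induction t with
  | zero => rfl
  | succ t ih =>
    have h := ih (fun n hn => hz n (hn.trans t.lt_succ_self))
      fun n hn => hv n (hn.trans t.lt_succ_self)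
    funext x
    simp only [iterate, h, hz t t.lt_succ_self, hv t t.lt_succ_self]

/-- The iterate after `t` steps as a function of the first `t` samples. -/
def sampleIterate [Nonempty ((X × ℝ) × V)] (φ : V → X → ℝ) (eta : ℝ) (t : ℕ)
    (p : Fin t → (X × ℝ) × V) : X → ℝ :=
  iterate φ (fun _ => eta) 0 (fun n => (extendFin p n).1) (fun n => (extendFin p n).2) t

theorem sampleIterate_snoc [Nonempty ((X × ℝ) × V)] (φ : V → X → ℝ) (eta : ℝ) (t : ℕ)
    (p : Fin t → (X × ℝ) × V) (s : (X × ℝ) × V) :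
    sampleIterate φ eta (t + 1) (Fin.snoc p s) = fun x => sampleIterate φ eta t p x -
      eta * ((sampleIterate φ eta t p s.1.1 - s.1.2) * φ s.2 s.1.1) * φ s.2 x := by
  have h : iterate φ (fun _ => eta) 0
      (fun n => (extendFin (Fin.snoc p s : Fin (t + 1) → (X × ℝ) × V) n).1)
      (fun n => (extendFin (Fin.snoc p s : Fin (t + 1) → (X × ℝ) × V) n).2) t =
      sampleIterate φ eta t p :=
    iterate_congr (fun n hn => by rw [extendFin_snoc_of_lt p s hn])
      fun n hn => by rw [extendFin_snoc_of_lt p s hn]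
  funext x
  rw [sampleIterate, iterate, h, extendFin_snoc_last]
  ring

variable [MeasurableSpace X] [MeasurableSpace V]

theorem measurable_iterate {A : Type*} [MeasurableSpace A] {φ : V → X → ℝ}
    (hφ : Measurable fun p : V × X => φ p.1 p.2) {η : ℕ → ℝ} {lam : ℝ} {z : A → ℕ → X × ℝ}
    {v : A → ℕ → V} (hz : ∀ n, Measurable fun a => z a n) (hv : ∀ n, Measurable fun a => v a n)
    (t : ℕ) : Measurable fun p : A × X => iterate φ η lam (z p.1) (v p.1) t p.2 := by
  induction t with
  | zero => exact measurable_const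
  | succ t ih =>
    have hz' : Measurable fun p : A × X => z p.1 t := (hz t).comp measurable_fst
    have hv' : Measurable fun p : A × X => v p.1 t := (hv t).comp measurable_fst
    have h1 : Measurable fun p : A × X => iterate φ η lam (z p.1) (v p.1) t (z p.1 t).1 :=
      ih.comp (measurable_fst.prodMk hz'.fst)
    have h2 : Measurable fun p : A × X => φ (v p.1 t) (z p.1 t).1 :=
      hφ.comp (hv'.prodMk hz'.fst)
    have h3 : Measurable fun p : A × X => φ (v p.1 t) p.2 := hφ.comp (hv'.prodMk measurable_snd)
    exact (ih.const_mul _).sub ((((h1.sub hz'.snd).const_mul _).mul h2).mul h3)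

theorem memLp_iterate {V : Type*} {ν : Measure X} {φ : V → X → ℝ} (hφ : ∀ v, MemLp (φ v) 2 ν) {η : ℕ → ℝ}
    {lam : ℝ} (z : ℕ → X × ℝ) (v : ℕ → V) (t : ℕ) : MemLp (iterate φ η lam z v t) 2 ν := by
  induction t with
  | zero => exact MemLp.zero'
  | succ t ih => exact (ih.const_mul _).sub ((hφ (v t)).const_mul _)

theorem measurable_sampleIterate [Nonempty ((X × ℝ) × V)] {φ : V → X → ℝ}
    (hφ : Measurable fun p : V × X => φ p.1 p.2) (eta : ℝ) (t : ℕ) :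
    Measurable fun q : (Fin t → (X × ℝ) × V) × X => sampleIterate φ eta t q.1 q.2 :=
  measurable_iterate hφ (fun n => (measurable_extendFin n).fst)
    (fun n => (measurable_extendFin n).snd) t

end Iterate

/-- A triangular recursion whose inhomogeneity involves only its column `0`. -/
theorem le_of_triangular_recursion {A : ℕ → ℕ → ℝ≥0∞} {c e M : ℝ≥0∞} {τ : ℕ → ℝ≥0∞} {T : ℕ}
    (hA : ∀ t k, A (t + 1) k ≤ A t (k + 1) + c * (A t 0 + e) * τ k)
    (hM : ∀ t ≤ T, A 0 t + c * (M + e) * ∑ j ∈ Finset.range t, τ j ≤ M) {t : ℕ} (ht : t ≤ T)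
    (k : ℕ) :
    A t k ≤ A 0 (k + t) + c * (M + e) * ∑ j ∈ Finset.range t, τ (k + j) := by
  induction t generalizing k with
  | zero => simp
  | succ t ih =>
    have ht' : t ≤ T := (Nat.le_succ t).trans ht
    -- The induction hypothesis in column `0` together with `hM` returns the bound `M`, which turns
    -- the noise into a constant multiple of `τ k`.
    have h0 : A t 0 ≤ M := by
      refine (ih ht' 0).trans ?_
      simpa using hM t ht'
    calc A (t + 1) k ≤ A t (k + 1) + c * (A t 0 + e) * τ k := hA t k
      _ ≤ (A 0 (k + 1 + t) + c * (M + e) * ∑ j ∈ Finset.range t, τ (k + 1 + j)) +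
          c * (M + e) * τ k := by gcongr; exact ih ht' (k + 1)
      _ = _ := by
        rw [Finset.sum_range_succ', add_assoc, ← mul_add, add_zero]
        simp only [add_right_comm k 1, add_assoc]

/-! ### Unrolling the error recursion. -/

section Recursion

variable {X : Type*} [MeasurableSpace X]
  {V : Type*} [MeasurableSpace V]
  {ρ : Measure (X × ℝ)} [IsProbabilityMeasure ρ] {μ : Measure V} [IsProbabilityMeasure μ]
  {φ : V → X → ℝ} {κ : ℝ} [Nonempty ((X × ℝ) × V)]

variable (φ ρ μ) in
/-- The mean of `‖B (f - f_ρ)‖²` over the iterates `f` after `t` steps. -/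
def meanSqError (B : Lp ℂ 2 ρ.fst →L[ℂ] Lp ℂ 2 ρ.fst) (eta : ℝ) (t : ℕ) : ℝ≥0∞ :=
  ∫⁻ p, ENNReal.ofReal (‖B (toL2 ρ.fst (sampleIterate φ eta t p)
    - toL2 ρ.fst (regressionFunction ρ))‖ ^ 2) ∂(Measure.pi fun _ : Fin t => ρ.prod μ)

theorem meanSqError_zero (B : Lp ℂ 2 ρ.fst →L[ℂ] Lp ℂ 2 ρ.fst) (eta : ℝ) :
    meanSqError ρ μ φ B eta 0 = ENNReal.ofReal (‖B (toL2 ρ.fst (regressionFunction ρ))‖ ^ 2) := by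
  have (p : Fin 0 → (X × ℝ) × V) : sampleIterate φ eta 0 p = fun _ => 0 := rfl
  simp_rw [meanSqError, this, toL2_zero, zero_sub, map_neg, norm_neg]
  rw [lintegral_const, measure_univ, mul_one]

variable [MeasurableSpace.CountablyGenerated X]

theorem IsBoundedFeature.measurable_norm_sampleIterate (hφ : IsBoundedFeature φ ρ.fst κ)
    (B : Lp ℂ 2 ρ.fst →L[ℂ] Lp ℂ 2 ρ.fst) (r : Lp ℂ 2 ρ.fst) (eta : ℝ) (t : ℕ) :
    Measurable fun p : Fin t → (X × ℝ) × V =>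
      ENNReal.ofReal (‖B (toL2 ρ.fst (sampleIterate φ eta t p) - r)‖ ^ 2) :=
  ((B.continuous.comp_stronglyMeasurable
    ((stronglyMeasurable_toL2 (measurable_sampleIterate hφ.measurable eta t)
      fun _ => memLp_iterate hφ.memLp _ _ t).sub
        stronglyMeasurable_const)).norm.pow 2).measurable.ennreal_ofReal

theorem IsBoundedFeature.meanSqError_succ_le (hφ : IsBoundedFeature φ ρ.fst κ)
    (hy : Integrable (fun z : X × ℝ => z.2 ^ 2) ρ) (hρ : MemLp (regressionFunction ρ) 2 ρ.fst)
    {L : Lp ℂ 2 ρ.fst →L[ℂ] Lp ℂ 2 ρ.fst}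
    (hL : IsMeanRankOne L μ (fun v => toL2 ρ.fst (φ v)) κ) (B : Lp ℂ 2 ρ.fst →L[ℂ] Lp ℂ 2 ρ.fst)
    (eta : ℝ) (t : ℕ) :
    meanSqError ρ μ φ B eta (t + 1) ≤ meanSqError ρ μ φ (B * (1 - (eta : ℂ) • L)) eta t +
      ENNReal.ofReal (eta ^ 2 * κ ^ 2) *
        (meanSqError ρ μ φ 1 eta t + ENNReal.ofReal (expectedRisk ρ (regressionFunction ρ))) *
        ∫⁻ v, ENNReal.ofReal (‖B (toL2 ρ.fst (φ v))‖ ^ 2) ∂μ := by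
  have hm0 : Measurable fun p : Fin t → (X × ℝ) × V => ENNReal.ofReal
      (‖toL2 ρ.fst (sampleIterate φ eta t p) - toL2 ρ.fst (regressionFunction ρ)‖ ^ 2) :=
    hφ.measurable_norm_sampleIterate 1 _ eta t
  have hm1 := hφ.measurable_norm_sampleIterate (V := V) (B * (1 - (eta : ℂ) • L))
    (toL2 ρ.fst (regressionFunction ρ)) eta t
  have h1 : ∀ p : Fin t → (X × ℝ) × V, _ :=
    fun p => hφ.lintegral_norm_step_le hy hρ hL (f := sampleIterate φ eta t p)
      (memLp_iterate hφ.memLp _ _ t) B eta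
  rw [meanSqError, lintegral_pi_fin_succ _ (hφ.measurable_norm_sampleIterate _ _ eta (t + 1))]
  simp_rw [sampleIterate_snoc]
  refine (lintegral_mono h1).trans (le_of_eq ?_)
  refine (lintegral_add_left hm1 _).trans ?_
  rw [lintegral_mul_const _ ((hm0.add_const _).const_mul _), lintegral_const_mul _ (hm0.add_const _),
    lintegral_add_left hm0, lintegral_const, measure_univ, mul_one]
  rfl

/-- Apply the triangular recursion to `B = (1 - eta L)^k`: a step raises `k` by one, and column `0`
is the error itself. -/
theorem IsBoundedFeature.meanSqError_le (hφ : IsBoundedFeature φ ρ.fst κ)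
    (hy : Integrable (fun z : X × ℝ => z.2 ^ 2) ρ) (hρ : MemLp (regressionFunction ρ) 2 ρ.fst)
    {L : Lp ℂ 2 ρ.fst →L[ℂ] Lp ℂ 2 ρ.fst}
    (hL : IsMeanRankOne L μ (fun v => toL2 ρ.fst (φ v)) κ) (eta : ℝ) {M : ℝ≥0∞} {T : ℕ}
    (hM : ∀ t ≤ T, ENNReal.ofReal
        (‖((1 - (eta : ℂ) • L) ^ t) (toL2 ρ.fst (regressionFunction ρ))‖ ^ 2) +
      ENNReal.ofReal (eta ^ 2 * κ ^ 2) *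
        (M + ENNReal.ofReal (expectedRisk ρ (regressionFunction ρ))) *
        ∑ k ∈ Finset.range t,
          ∫⁻ v, ENNReal.ofReal (‖((1 - (eta : ℂ) • L) ^ k) (toL2 ρ.fst (φ v))‖ ^ 2) ∂μ ≤ M) :
    meanSqError ρ μ φ 1 eta T ≤
      ENNReal.ofReal (‖((1 - (eta : ℂ) • L) ^ T) (toL2 ρ.fst (regressionFunction ρ))‖ ^ 2) +
      ENNReal.ofReal (eta ^ 2 * κ ^ 2) *
        (M + ENNReal.ofReal (expectedRisk ρ (regressionFunction ρ))) *
        ∑ k ∈ Finset.range T,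
          ∫⁻ v, ENNReal.ofReal (‖((1 - (eta : ℂ) • L) ^ k) (toL2 ρ.fst (φ v))‖ ^ 2) ∂μ := by
  have h := le_of_triangular_recursion (T := T)
    (A := fun t k => meanSqError ρ μ φ ((1 - (eta : ℂ) • L) ^ k) eta t)
    (fun t k => by
      have h := hφ.meanSqError_succ_le hy hρ hL ((1 - (eta : ℂ) • L) ^ k) eta t
      rw [← pow_succ] at h
      simpa only [pow_zero] using h)
    (fun t ht => by simpa only [meanSqError_zero] using hM t ht) le_rfl 0
  simpa only [meanSqError_zero, pow_zero, zero_add] using h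

end Recursion

/-! ### Step size arithmetic and rates. -/

section Rates

/-- Use `k^(γ-1) ≤ T^γ / k` and the harmonic sum. The logarithm of the final rate arises here; in
exchange the bound is uniform in `γ`, down to `γ = 0`. -/
theorem sum_range_rpow_sub_one_le {γ : ℝ} (hγ : 0 ≤ γ) {n T : ℕ} (hn : n + 1 ≤ T) :
    ∑ j ∈ Finset.range n, ((j + 1 : ℕ) : ℝ) ^ (γ - 1) ≤ (T : ℝ) ^ γ * (1 + Real.log T) := by
  have hT : (0 : ℝ) < T := by exact_mod_cast (by omega : 0 < T)
  have h1 : ∑ j ∈ Finset.range n, ((j + 1 : ℕ) : ℝ)⁻¹ ≤ 1 + Real.log T := by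
    have h2 := harmonic_le_one_add_log T
    simp only [harmonic, Rat.cast_sum, Rat.cast_inv, Rat.cast_natCast] at h2
    exact (Finset.sum_le_sum_of_subset_of_nonneg (Finset.range_mono (by omega))
      fun i _ _ => by positivity).trans h2
  calc ∑ j ∈ Finset.range n, ((j + 1 : ℕ) : ℝ) ^ (γ - 1)
      ≤ ∑ j ∈ Finset.range n, (T : ℝ) ^ γ * ((j + 1 : ℕ) : ℝ)⁻¹ := by
        refine Finset.sum_le_sum fun j hj => ?_
        have hj' : ((j + 1 : ℕ) : ℝ) ≤ T := by
          have := Finset.mem_range.1 hj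
          exact_mod_cast (by omega : j + 1 ≤ T)
        have hj0 : (0 : ℝ) < ((j + 1 : ℕ) : ℝ) := by positivity
        rw [Real.rpow_sub_one hj0.ne', div_eq_mul_inv]
        gcongr
    _ ≤ _ := by rw [← Finset.mul_sum]; gcongr

/-- The constant factor of the step size. -/
def stepConst (κ cγ ζ : ℝ) : ℝ := ζ / (4 * κ ^ 2 * (cγ + κ ^ 2) * (ζ + 1))

variable {κ cγ γ ζ : ℝ} {T : ℕ}

theorem stepConst_pos (hκ : 1 ≤ κ) (hζ : 0 < ζ) (hc : 0 < cγ) : 0 < stepConst κ cγ ζ := by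
  unfold stepConst; positivity

theorem stepConst_mul (hκ : 1 ≤ κ) (hζ : 0 < ζ) (hc : 0 < cγ) :
    stepConst κ cγ ζ * (κ ^ 2 * (cγ + κ ^ 2)) = ζ / (ζ + 1) / 4 := by
  unfold stepConst; field_simp

theorem stepConst_mul_sq_le (hκ : 1 ≤ κ) (hζ : 0 < ζ) (hc : 0 < cγ) :
    stepConst κ cγ ζ * κ ^ 2 ≤ 1 / 4 := by
  have h1 : ζ / (ζ + 1) ≤ 1 := by rw [div_le_one (by positivity)]; linarith
  have h2 := stepConst_mul hκ hζ hc
  have h3 : 0 ≤ stepConst κ cγ ζ * κ ^ 2 :=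
    mul_nonneg (stepConst_pos hκ hζ hc).le (sq_nonneg κ)
  nlinarith

theorem stepConst_le (hκ : 1 ≤ κ) (hζ : 0 < ζ) (hc : 0 < cγ) : stepConst κ cγ ζ ≤ 1 / 4 := by
  have h2 := stepConst_mul_sq_le hκ hζ hc
  exact (le_mul_of_one_le_right (stepConst_pos hκ hζ hc).le (one_le_pow₀ hκ)).trans h2

theorem stepSize_pos (hκ : 1 ≤ κ) (hζ : 0 < ζ) (hc : 0 < cγ) (hT : 2 ≤ T) :
    0 < stepSize κ cγ γ ζ T := by
  have : (0 : ℝ) < T := by exact_mod_cast (by omega : 0 < T)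
  have h := stepConst_pos hκ hζ hc
  exact mul_pos h (by positivity)

theorem stepSize_le (hκ : 1 ≤ κ) (hζ : 0 < ζ) (hc : 0 < cγ) (hγ : 0 ≤ γ) (hT : 2 ≤ T) :
    stepSize κ cγ γ ζ T ≤ stepConst κ cγ ζ * (T : ℝ) ^ (-(2 * ζ / (2 * ζ + γ + 1))) := by
  have h1 : (1 : ℝ) ≤ T := by exact_mod_cast (by omega : 1 ≤ T)
  refine mul_le_mul_of_nonneg_left (Real.rpow_le_rpow_of_exponent_le h1 (neg_le_neg ?_))
    (stepConst_pos hκ hζ hc).le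
  rw [show 2 * ζ + γ + 1 = γ + 2 * ζ + 1 by ring]
  gcongr
  linarith

theorem rpow_neg_rate_le_one (hζ : 0 < ζ) (hγ : 0 ≤ γ) (hT : 2 ≤ T) :
    (T : ℝ) ^ (-(2 * ζ / (2 * ζ + γ + 1))) ≤ 1 := by
  have h1 : (1 : ℝ) ≤ T := by exact_mod_cast (by omega : 1 ≤ T)
  exact Real.rpow_le_one_of_one_le_of_nonpos h1 (neg_nonpos.2 (by positivity))

theorem stepSize_mul_sq_le (hκ : 1 ≤ κ) (hζ : 0 < ζ) (hc : 0 < cγ) (hγ : 0 ≤ γ) (hT : 2 ≤ T) :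
    stepSize κ cγ γ ζ T * κ ^ 2 ≤ 1 / 4 := by
  have h := stepSize_le hκ hζ hc hγ hT
  have h1 := rpow_neg_rate_le_one hζ hγ hT
  have h2 := stepConst_pos hκ hζ hc
  refine le_trans ?_ (stepConst_mul_sq_le hκ hζ hc)
  gcongr
  nlinarith

theorem stepSize_mul_natCast (hζ : 0 < ζ) (hγ : 0 ≤ γ) (hT : 2 ≤ T) :
    stepSize κ cγ γ ζ T * T = stepConst κ cγ ζ * (T : ℝ) ^ (1 / (2 * ζ + γ + 1)) := by
  have h1 : (0 : ℝ) < T := by exact_mod_cast (by omega : 0 < T)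
  rw [stepSize, mul_assoc]
  congr 1
  conv_lhs => rw [← Real.rpow_one (T : ℝ), ← Real.rpow_mul h1.le, one_mul]
  rw [← Real.rpow_add h1]
  congr 1
  field_simp
  ring

/-- The powers of `T` match exactly; the leftover `(2 * stepConst)^γ` is at most `1`, so no
dependence on `γ` remains. -/
theorem stepSize_mul_rpow (hκ : 1 ≤ κ) (hζ : 0 < ζ) (hc : 0 < cγ) (hγ : 0 ≤ γ) (hT : 2 ≤ T) :
    stepSize κ cγ γ ζ T * (2 * stepSize κ cγ γ ζ T * T) ^ γ ≤
      stepConst κ cγ ζ * (T : ℝ) ^ (-(2 * ζ / (2 * ζ + γ + 1))) := by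
  have h1 : (0 : ℝ) < T := by exact_mod_cast (by omega : 0 < T)
  have h2 := stepConst_pos hκ hζ hc
  have h3 := stepConst_le hκ hζ hc
  have h4 : (2 * stepConst κ cγ ζ) ^ γ ≤ 1 := Real.rpow_le_one (by positivity) (by linarith) hγ
  rw [mul_assoc 2, stepSize_mul_natCast hζ hγ hT, ← mul_assoc, Real.mul_rpow (by positivity)
    (by positivity), ← Real.rpow_mul h1.le]
  have h5 : stepSize κ cγ γ ζ T * (T : ℝ) ^ (1 / (2 * ζ + γ + 1) * γ) =
      stepConst κ cγ ζ * (T : ℝ) ^ (-(2 * ζ / (2 * ζ + γ + 1))) := by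
    rw [stepSize, mul_assoc, ← Real.rpow_add h1]
    congr 2
    field_simp
    ring
  rw [mul_left_comm, h5]
  exact mul_le_of_le_one_left (by positivity) h4

/-- Upper bound for `η² κ² ∑ₖ ∫ ‖(1 - η L) ^ k φ_v‖² dμ(v)`. -/
theorem variance_factor_le (hκ : 1 ≤ κ) (hζ : 0 < ζ) (hc : 0 < cγ) (hγ : 0 ≤ γ)
    (hT : 2 ≤ T) :
    stepSize κ cγ γ ζ T ^ 2 * κ ^ 2 * (κ ^ 2 + 2 * cγ * (2 * stepSize κ cγ γ ζ T) ^ (γ - 1) *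
        ((T : ℝ) ^ γ * (1 + Real.log T))) ≤
      (T : ℝ) ^ (-(2 * ζ / (2 * ζ + γ + 1))) *
        (1 / 16 + ζ / (ζ + 1) / 4 * (1 + Real.log T)) := by
  have h1 : (1 : ℝ) ≤ T := by exact_mod_cast (by omega : 1 ≤ T)
  have hlog : 0 ≤ Real.log T := Real.log_nonneg h1
  set η := stepSize κ cγ γ ζ T with hη
  have hη0 : 0 < η := stepSize_pos hκ hζ hc hT
  have hc0 := stepConst_pos hκ hζ hc
  set c₀ := stepConst κ cγ ζ with hc₀
  set r := (T : ℝ) ^ (-(2 * ζ / (2 * ζ + γ + 1))) with hr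
  have hr0 : 0 < r := by positivity
  -- The share of `k = 0`: one factor `η κ²` yields the rate `r`, the other only `1/4`.
  have h2 : η ^ 2 * κ ^ 2 * κ ^ 2 ≤ r * (1 / 16) := by
    have ha : η * κ ^ 2 ≤ r * (1 / 4) := by
      calc η * κ ^ 2 ≤ c₀ * r * κ ^ 2 := by gcongr; exact stepSize_le hκ hζ hc hγ hT
        _ = r * (c₀ * κ ^ 2) := by ring
        _ ≤ r * (1 / 4) := by gcongr; exact stepConst_mul_sq_le hκ hζ hc
    have hb := stepSize_mul_sq_le hκ hζ hc hγ hT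
    calc η ^ 2 * κ ^ 2 * κ ^ 2 = (η * κ ^ 2) * (η * κ ^ 2) := by ring
      _ ≤ (r * (1 / 4)) * (1 / 4) := by gcongr
      _ = _ := by ring
  have h3 : η ^ 2 * (2 * (2 * η) ^ (γ - 1) * (T : ℝ) ^ γ) = η * (2 * η * T) ^ γ := by
    rw [Real.mul_rpow (by positivity) (by positivity : (0 : ℝ) ≤ T),
      Real.rpow_sub_one (by positivity)]
    field_simp
  have h4 : κ ^ 2 * cγ * c₀ ≤ ζ / (ζ + 1) / 4 := by
    rw [← stepConst_mul hκ hζ hc, ← hc₀]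
    nlinarith [mul_nonneg hc0.le (sq_nonneg (κ ^ 2))]
  calc _ = η ^ 2 * κ ^ 2 * κ ^ 2 + κ ^ 2 * cγ *
        (η ^ 2 * (2 * (2 * η) ^ (γ - 1) * (T : ℝ) ^ γ)) * (1 + Real.log T) := by ring
    _ ≤ r * (1 / 16) + κ ^ 2 * cγ * (c₀ * r) * (1 + Real.log T) := by
      rw [h3]
      gcongr ?_ + κ ^ 2 * cγ * ?_ * (1 + Real.log T)
      exact stepSize_mul_rpow hκ hζ hc hγ hT
    _ = r * (1 / 16 + κ ^ 2 * cγ * c₀ * (1 + Real.log T)) := by ring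
    _ ≤ _ := by gcongr

/-- For the rate exponent `a` one has `log T ≤ T^a / a` and, as `γ ≤ 1`, `a ≥ ζ/(ζ+1)`. The factor
`ζ/(ζ+1)` of the step size thus absorbs `1/a`, and `9/16 = 1/16 + 1/4 + 1/4` for all `ζ`. -/
theorem variance_factor_le_const (hζ : 0 < ζ) (hγ : 0 ≤ γ) (hγ1 : γ ≤ 1) (hT : 2 ≤ T) :
    (T : ℝ) ^ (-(2 * ζ / (2 * ζ + γ + 1))) * (1 / 16 + ζ / (ζ + 1) / 4 * (1 + Real.log T)) ≤
      9 / 16 := by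
  have h1 : (1 : ℝ) ≤ T := by exact_mod_cast (by omega : 1 ≤ T)
  have h0 : (0 : ℝ) < T := by linarith
  have ha : ζ / (ζ + 1) ≤ 2 * ζ / (2 * ζ + γ + 1) := by
    rw [div_le_div_iff₀ (by positivity) (by positivity)]
    nlinarith
  have hq0 : 0 < ζ / (ζ + 1) := by positivity
  have hq : ζ / (ζ + 1) ≤ 1 := by rw [div_le_one (by positivity)]; linarith
  have hr1 := rpow_neg_rate_le_one hζ hγ hT
  set a := 2 * ζ / (2 * ζ + γ + 1) with hadef
  have ha0 : 0 < a := hq0.trans_le ha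
  set r := (T : ℝ) ^ (-a) with hr
  have hr0 : 0 < r := by positivity
  have hlog : r * (ζ / (ζ + 1) * Real.log T) ≤ 1 := by
    have h2 : Real.log T ≤ (T : ℝ) ^ a / a := Real.log_le_rpow_div h0.le ha0
    have h3 : r * (T : ℝ) ^ a = 1 := by rw [hr, ← Real.rpow_add h0]; simp
    have h4 : 0 ≤ Real.log T := Real.log_nonneg h1
    calc r * (ζ / (ζ + 1) * Real.log T) ≤ r * (a * ((T : ℝ) ^ a / a)) := by gcongr
      _ = r * (T : ℝ) ^ a := by field_simp
      _ = 1 := h3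
  nlinarith [mul_le_mul hr1 hq hq0.le zero_le_one]

theorem half_le_log_natCast (hT : 2 ≤ T) : 1 / 2 ≤ Real.log T := by
  have h2 : Real.log 2 ≤ Real.log T :=
    Real.log_le_log (by norm_num) (by exact_mod_cast hT)
  linarith [Real.log_two_gt_d9]

theorem variance_factor_le_log (hζ : 0 < ζ) (hT : 2 ≤ T) :
    1 / 16 + ζ / (ζ + 1) / 4 * (1 + Real.log T) ≤ Real.log T := by
  have hq0 : 0 < ζ / (ζ + 1) := by positivity
  have hq : ζ / (ζ + 1) ≤ 1 := by rw [div_le_one (by positivity)]; linarith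
  have h := half_le_log_natCast hT
  nlinarith

theorem bias_factor_eq (hκ : 1 ≤ κ) (hζ : 0 < ζ) (hc : 0 < cγ) (hγ : 0 ≤ γ) (hT : 2 ≤ T) :
    ((ζ / (stepSize κ cγ γ ζ T * T)) ^ ζ) ^ 2 =
      (4 * κ ^ 2 * (cγ + κ ^ 2) * (ζ + 1)) ^ (2 * ζ) *
        (T : ℝ) ^ (-(2 * ζ / (2 * ζ + γ + 1))) := by
  have h0 : (0 : ℝ) < T := by exact_mod_cast (by omega : 0 < T)
  have h1 : ζ / (stepSize κ cγ γ ζ T * T) =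
      4 * κ ^ 2 * (cγ + κ ^ 2) * (ζ + 1) * (T : ℝ) ^ (-(1 / (2 * ζ + γ + 1))) := by
    rw [stepSize_mul_natCast hζ hγ hT, stepConst, Real.rpow_neg h0.le]
    field_simp
  rw [h1, ← Real.rpow_natCast, ← Real.rpow_mul (by positivity), Real.mul_rpow (by positivity)
    (by positivity), ← Real.rpow_mul h0.le]
  congr 2
  · push_cast; ring
  · push_cast; ring

end Rates

/-! ### Pointwise bounds drawn from the hypotheses. -/

section Reduction

variable {X : Type*} [MeasurableSpace X] {V : Type*} [MeasurableSpace V]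

/-- On `A ×ˢ A` with `A = {κ < ψ}` or `A = {ψ < -κ}` the product exceeds `κ²`, so `ν(A)² = 0`. -/
theorem ae_abs_le_of_ae_mul_le {ν : Measure X} [SFinite ν] {ψ : X → ℝ}
    {κ : ℝ} (hκ : 0 ≤ κ) (h : ∀ᵐ q ∂(ν.prod ν), ψ q.1 * ψ q.2 ≤ κ ^ 2) :
    ∀ᵐ x ∂ν, |ψ x| ≤ κ := by
  have key : ∀ A : Set X, (∀ x ∈ A, ∀ y ∈ A, κ ^ 2 < ψ x * ψ y) → ν A = 0 := by
    intro A hA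
    have h1 : (ν.prod ν) (A ×ˢ A) = 0 :=
      measure_mono_null (fun q hq => not_le.2 (hA q.1 hq.1 q.2 hq.2)) h
    rw [Measure.prod_prod] at h1
    simpa using h1
  have h1 : ∀ᵐ x ∂ν, ¬ κ < ψ x := by
    have := key {x | κ < ψ x} fun x hx y hy => by
      have hx' : κ < ψ x := hx
      have hy' : κ < ψ y := hy
      nlinarith
    exact measure_eq_zero_iff_ae_notMem.1 this
  have h2 : ∀ᵐ x ∂ν, ¬ ψ x < -κ := by
    have := key {x | ψ x < -κ} fun x hx y hy => by
      have hx' : ψ x < -κ := hx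
      have hy' : ψ y < -κ := hy
      nlinarith
    exact measure_eq_zero_iff_ae_notMem.1 this
  filter_upwards [h1, h2] with x h1 h2
  exact _root_.abs_le.2 ⟨not_lt.1 h2, not_lt.1 h1⟩

variable {K : X → X → ℝ} {μ : Measure V} {φ : V → X → ℝ} {ρ : Measure (X × ℝ)} {κ : ℝ}

theorem IsRandomFeature.abs_kernel_le (hφ : IsRandomFeature K μ φ ρ) (hb : BoundedBy κ K μ φ ρ)
    (x x' : X) : |K x x'| ≤ κ ^ 2 := by
  have h1 := (hφ.memLp_section x).integrable_sq
  have h2 := (hφ.memLp_section x').integrable_sq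
  have h12 : Integrable (fun v => φ v x * φ v x') μ :=
    (hφ.memLp_section x).integrable_mul (hφ.memLp_section x')
  have e : ∀ y, K y y = ∫ v, φ v y ^ 2 ∂μ := fun y => by simp_rw [hφ.kernel_eq, sq]
  have hx := hb.kernel_le x
  have hx' := hb.kernel_le x'
  rw [e] at hx hx'
  have h3 : |K x x'| ≤ ∫ v, (φ v x ^ 2 + φ v x' ^ 2) / 2 ∂μ := by
    rw [hφ.kernel_eq]
    refine abs_integral_le_integral_abs.trans (integral_mono h12.abs ((h1.add h2).div_const 2)
      fun v => ?_)
    refine _root_.abs_le.2 ⟨?_, ?_⟩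
    · nlinarith [sq_nonneg (φ v x + φ v x')]
    · nlinarith [sq_nonneg (φ v x - φ v x')]
  have h4 : ∫ v, (φ v x ^ 2 + φ v x' ^ 2) / 2 ∂μ =
      (∫ v, φ v x ^ 2 ∂μ + ∫ v, φ v x' ^ 2 ∂μ) / 2 := by
    rw [integral_div, integral_add h1 h2]
  linarith

theorem ofReal_norm_toL2_sub_sq {f g : X → ℝ} (hf : MemLp f 2 ρ.fst) (hg : MemLp g 2 ρ.fst) :
    ENNReal.ofReal (‖toL2 ρ.fst f - toL2 ρ.fst g‖ ^ 2) = rhoNorm ρ (fun x => f x - g x) ^ 2 := by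
  have h : MemLp (fun x => f x - g x) 2 ρ.fst := hf.sub hg
  rw [← toL2_sub hf hg, ENNReal.ofReal_pow (norm_nonneg _), ofReal_norm, enorm_toL2 h, rhoNorm]

variable [IsProbabilityMeasure ρ]

theorem BoundedBy.ae_feature (hb : BoundedBy κ K μ φ ρ) :
    ∀ᵐ v ∂μ, ∀ᵐ x ∂ρ.fst, |φ v x| ≤ κ := by
  filter_upwards [Measure.ae_ae_of_ae_prod hb.feature_le] with v hv
  exact ae_abs_le_of_ae_mul_le (zero_le_one.trans hb.one_le) hv

theorem IsRandomFeature.kernelMemL2 (hφ : IsRandomFeature K μ φ ρ) (hb : BoundedBy κ K μ φ ρ) :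
    KernelMemL2 K ρ.fst :=
  .of_bound hb.measurable_kernel.aestronglyMeasurable (κ ^ 2)
    (.of_forall fun q => hφ.abs_kernel_le hb q.1 q.2)

theorem SourceCondition.memLp {ζ R : ℝ} (hs : SourceCondition ζ R K ρ) :
    MemLp (regressionFunction ρ) 2 ρ.fst := by
  obtain ⟨g, -, hg⟩ := hs
  have h1 : MemLp (fun x => (regressionFunction ρ x : ℂ)) 2 ρ.fst :=
    (memLp_congr_ae hg).1 (Lp.memLp _)
  simpa using h1.re

end Reduction

/-- The constant of the convergence rate. -/
def rateConst (R ζ normFρ riskFρ κ cγ : ℝ) : ℝ :=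
  2 * R ^ 2 * (4 * κ ^ 2 * (cγ + κ ^ 2) * (ζ + 1)) ^ (2 * ζ) + 3 * normFρ ^ 2 + 4 * riskFρ

/-! ### The convergence rate. -/

section Rate

variable {X : Type*} [MeasurableSpace X] [MeasurableSpace.CountablyGenerated X]
  {V : Type*} [MeasurableSpace V]
  {ρ : Measure (X × ℝ)} [IsProbabilityMeasure ρ] {μ : Measure V} [IsProbabilityMeasure μ]
  {φ : V → X → ℝ} {K : X → X → ℝ} {κ γ cγ ζ R : ℝ} {T : ℕ}

theorem lintegral_feature_le_of_capacity
    (hL : IsMeanRankOne (LK K ρ) μ (fun v => toL2 ρ.fst (φ v)) κ) {eta : ℝ} (heta : 0 < eta)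
    (hetaκ : eta * κ ^ 2 ≤ 1) (hcap : CapacityCondition γ cγ K ρ) {k : ℕ} (hk : 0 < k) :
    ∫⁻ v, ENNReal.ofReal (‖((1 - (eta : ℂ) • LK K ρ) ^ k) (toL2 ρ.fst (φ v))‖ ^ 2) ∂μ ≤
      ENNReal.ofReal (2 * cγ * (2 * eta) ^ (γ - 1) * (k : ℝ) ^ (γ - 1)) := by
  -- Makes separability of `L²` available for the trace formula.
  have : Fact ((2 : ℝ≥0∞) ≠ ∞) := ⟨by norm_num⟩
  have hk' : (0 : ℝ) < k := by exact_mod_cast hk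
  -- This value equalizes the two summands of the spectral bound, whose sum becomes `2 * lam`.
  set lam : ℝ := (eta * (2 * k : ℕ))⁻¹ with hlamdef
  have hlam : 0 < lam := by positivity
  refine (hL.lintegral_one_sub_smul_pow_le heta hetaκ hlam hk).trans ?_
  rw [← hlamdef]
  refine (mul_le_mul_right (hcap lam hlam) _).trans (le_of_eq ?_)
  rw [← ENNReal.ofReal_mul (by positivity)]
  congr 1
  have h1 : lam = (2 * eta * k)⁻¹ := by rw [hlamdef]; push_cast; ring
  have h2 : (2 * eta) ^ (γ - 1) * (k : ℝ) ^ (γ - 1) = lam * lam ^ (-γ) := by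
    rw [← Real.mul_rpow (by positivity) hk'.le, h1, Real.inv_rpow (by positivity),
      Real.rpow_neg (by positivity), inv_inv, Real.rpow_sub_one (by positivity), div_eq_inv_mul]
  rw [mul_assoc (2 * cγ), h2]
  ring

theorem IsBoundedFeature.sum_lintegral_feature_le (hφ : IsBoundedFeature φ ρ.fst κ)
    (hL : IsMeanRankOne (LK K ρ) μ (fun v => toL2 ρ.fst (φ v)) κ) {eta : ℝ} (heta : 0 < eta)
    (hetaκ : eta * κ ^ 2 ≤ 1) (hγ : 0 ≤ γ) (hc : 0 < cγ) (hcap : CapacityCondition γ cγ K ρ)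
    {t : ℕ} (ht : t ≤ T) (hT : 2 ≤ T) :
    ∑ k ∈ Finset.range t,
      ∫⁻ v, ENNReal.ofReal (‖((1 - (eta : ℂ) • LK K ρ) ^ k) (toL2 ρ.fst (φ v))‖ ^ 2) ∂μ ≤
      ENNReal.ofReal (κ ^ 2 + 2 * cγ * (2 * eta) ^ (γ - 1) *
        ((T : ℝ) ^ γ * (1 + Real.log T))) := by
  obtain ⟨n, rfl⟩ : ∃ n, T = n + 1 := ⟨T - 1, by omega⟩
  refine (Finset.sum_le_sum_of_subset (Finset.range_mono ht)).trans ?_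
  -- The term `k = 0`, out of reach of the capacity bound, is split off and bounded by `κ²`.
  rw [Finset.sum_range_succ', add_comm]
  have hlog : 0 ≤ Real.log ((n + 1 : ℕ) : ℝ) := Real.log_natCast_nonneg _
  rw [ENNReal.ofReal_add (by positivity) (by positivity)]
  refine add_le_add ?_ ?_
  · calc _ ≤ ∫⁻ _, ENNReal.ofReal (κ ^ 2) ∂μ := by
          refine lintegral_mono fun v => ENNReal.ofReal_le_ofReal ?_
          rw [pow_zero]
          exact pow_le_pow_left₀ (norm_nonneg _) (hφ.norm_toL2_le v) 2
      _ = _ := by simp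
  · calc _ ≤ ∑ j ∈ Finset.range n,
          ENNReal.ofReal (2 * cγ * (2 * eta) ^ (γ - 1) * ((j + 1 : ℕ) : ℝ) ^ (γ - 1)) :=
          Finset.sum_le_sum fun j _ =>
            lintegral_feature_le_of_capacity hL heta hetaκ hcap j.succ_pos
      _ = ENNReal.ofReal (2 * cγ * (2 * eta) ^ (γ - 1) *
            ∑ j ∈ Finset.range n, ((j + 1 : ℕ) : ℝ) ^ (γ - 1)) := by
          rw [Finset.mul_sum, ENNReal.ofReal_sum_of_nonneg fun _ _ => by positivity]
      _ ≤ _ := by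
          refine ENNReal.ofReal_le_ofReal ?_
          gcongr
          exact sum_range_rpow_sub_one_le hγ le_rfl

theorem IsBoundedFeature.meanSqError_le_rate [Nonempty ((X × ℝ) × V)]
    (hφ : IsBoundedFeature φ ρ.fst κ)
    (hL : IsMeanRankOne (LK K ρ) μ (fun v => toL2 ρ.fst (φ v)) κ) (hκ : 1 ≤ κ)
    (hy : Integrable (fun z : X × ℝ => z.2 ^ 2) ρ) (hζ : 0 < ζ)
    (hs : SourceCondition ζ R K ρ) (hγ : 0 ≤ γ) (hγ1 : γ ≤ 1) (hc : 0 < cγ)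
    (hcap : CapacityCondition γ cγ K ρ) (hT : 2 ≤ T) :
    meanSqError ρ μ φ 1 (stepSize κ cγ γ ζ T) T ≤
      ENNReal.ofReal (rateConst R ζ (rhoNorm ρ (regressionFunction ρ)).toReal
        (expectedRisk ρ (regressionFunction ρ)) κ cγ *
          (T : ℝ) ^ (-(2 * ζ / (2 * ζ + γ + 1))) * Real.log T) := by
  have hρ := hs.memLp
  have hnorm : (rhoNorm ρ (regressionFunction ρ)).toReal =
      ‖toL2 ρ.fst (regressionFunction ρ)‖ := by
    rw [rhoNorm, ← enorm_toL2 hρ, toReal_enorm]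
  rw [hnorm]
  set N := ‖toL2 ρ.fst (regressionFunction ρ)‖ with hN
  set E := expectedRisk ρ (regressionFunction ρ) with hE
  have hE0 : 0 ≤ E := integral_nonneg fun z => sq_nonneg _
  set η := stepSize κ cγ γ ζ T with hη
  have hη0 : 0 < η := stepSize_pos hκ hζ hc hT
  have hη1 : η * κ ^ 2 ≤ 1 := (stepSize_mul_sq_le hκ hζ hc hγ hT).trans (by norm_num)
  have hLnn := hL.nonneg
  have hLn := hL.norm_le_sq
  have hlog : 0 ≤ Real.log T := Real.log_natCast_nonneg _
  set S := κ ^ 2 + 2 * cγ * (2 * η) ^ (γ - 1) * ((T : ℝ) ^ γ * (1 + Real.log T)) with hS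
  have hS0 : 0 ≤ S := by positivity
  set r := (T : ℝ) ^ (-(2 * ζ / (2 * ζ + γ + 1))) with hr
  have hr0 : 0 ≤ r := by positivity
  have hW : η ^ 2 * κ ^ 2 * S ≤ r * (1 / 16 + ζ / (ζ + 1) / 4 * (1 + Real.log T)) :=
    variance_factor_le hκ hζ hc hγ hT
  -- The variance factor is bounded twice: by a constant, to keep all errors below `M`, and at the
  -- final rate.
  have hW1 : η ^ 2 * κ ^ 2 * S ≤ 9 / 16 := hW.trans (variance_factor_le_const hζ hγ hγ1 hT)
  have hW2 : η ^ 2 * κ ^ 2 * S ≤ r * Real.log T :=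
    hW.trans (mul_le_mul_of_nonneg_left (variance_factor_le_log hζ hT) hr0)
  have hvar : ∀ t ≤ T, ENNReal.ofReal (η ^ 2 * κ ^ 2) *
      (ENNReal.ofReal (3 * N ^ 2 + 3 * E) + ENNReal.ofReal E) *
        ∑ k ∈ Finset.range t,
          ∫⁻ v, ENNReal.ofReal (‖((1 - (η : ℂ) • LK K ρ) ^ k) (toL2 ρ.fst (φ v))‖ ^ 2) ∂μ ≤
      ENNReal.ofReal ((3 * N ^ 2 + 4 * E) * (η ^ 2 * κ ^ 2 * S)) := by
    intro t ht
    calc _ ≤ ENNReal.ofReal (η ^ 2 * κ ^ 2) *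
          (ENNReal.ofReal (3 * N ^ 2 + 3 * E) + ENNReal.ofReal E) * ENNReal.ofReal S := by
          gcongr
          exact hφ.sum_lintegral_feature_le hL hη0 hη1 hγ hc hcap ht hT
      _ = _ := by
          rw [← ENNReal.ofReal_add (by positivity) hE0, ← ENNReal.ofReal_mul (by positivity),
            ← ENNReal.ofReal_mul (by positivity)]
          congr 1
          ring
  have hcontr : ∀ t : ℕ, ‖((1 - (η : ℂ) • LK K ρ) ^ t) (toL2 ρ.fst (regressionFunction ρ))‖ ≤ N := by
    intro t
    have h1 : ‖(1 - (η : ℂ) • LK K ρ) ^ t‖ ≤ 1 := by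
      rw [one_sub_smul_pow_eq_cfc hLnn]
      refine norm_cfc_le zero_le_one fun x hx => ?_
      obtain ⟨hx0, hxM⟩ := spectrum_subset_Icc hLnn hLn hx
      have h2 : η * x ≤ 1 := (mul_le_mul_of_nonneg_left hxM hη0.le).trans hη1
      have h3 : 0 ≤ η * x := by positivity
      rw [norm_pow]
      exact pow_le_one₀ (norm_nonneg _) (_root_.abs_le.2 ⟨by linarith, by linarith⟩)
    simpa using ContinuousLinearMap.le_of_opNorm_le _ h1 (toL2 ρ.fst (regressionFunction ρ))
  -- `M = 3N² + 3E` closes on itself because `N² + (9/16)(3N² + 4E) ≤ 3N² + 3E`.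
  have hmain := hφ.meanSqError_le hy hρ hL η (T := T) (M := ENNReal.ofReal (3 * N ^ 2 + 3 * E))
    fun t ht => by
      refine (add_le_add_right (hvar t ht) _).trans ?_
      rw [← ENNReal.ofReal_add (by positivity) (by positivity)]
      refine ENNReal.ofReal_le_ofReal ?_
      have h1 := pow_le_pow_left₀ (norm_nonneg _) (hcontr t) 2
      have h2 : (3 * N ^ 2 + 4 * E) * (η ^ 2 * κ ^ 2 * S) ≤ (3 * N ^ 2 + 4 * E) * (9 / 16) := by
        gcongr
      nlinarith [sq_nonneg N]
  refine hmain.trans ((add_le_add_right (hvar T le_rfl) _).trans ?_)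
  rw [← ENNReal.ofReal_add (by positivity) (by positivity)]
  refine ENNReal.ofReal_le_ofReal ?_
  have hbias : ‖((1 - (η : ℂ) • LK K ρ) ^ T) (toL2 ρ.fst (regressionFunction ρ))‖ ^ 2 ≤
      R ^ 2 * ((4 * κ ^ 2 * (cγ + κ ^ 2) * (ζ + 1)) ^ (2 * ζ) * r) := by
    obtain ⟨g, hgR, hg⟩ := hs
    rw [← eq_toL2 hρ hg]
    have h1 := norm_one_sub_smul_pow_opPow_le hLnn hLn hη0 hη1 hζ (by omega : 0 < T) g
    calc _ ≤ ((ζ / (η * T)) ^ ζ * ‖g‖) ^ 2 := by gcongr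
      _ ≤ ((ζ / (η * T)) ^ ζ * R) ^ 2 := by gcongr
      _ = _ := by rw [mul_pow, bias_factor_eq hκ hζ hc hγ hT, mul_comm]
  set D := (4 * κ ^ 2 * (cγ + κ ^ 2) * (ζ + 1)) ^ (2 * ζ) with hD
  have hD0 : 0 ≤ D := by positivity
  have hlog2 := half_le_log_natCast hT
  -- The factor `2` pays for `log T ≥ 1/2`.
  have h1 : R ^ 2 * (D * r) ≤ 2 * R ^ 2 * D * r * Real.log T := by
    have : 0 ≤ R ^ 2 * (D * r) := by positivity
    nlinarith
  have h2 : (3 * N ^ 2 + 4 * E) * (η ^ 2 * κ ^ 2 * S) ≤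
      (3 * N ^ 2 + 4 * E) * (r * Real.log T) := by gcongr
  calc _ ≤ 2 * R ^ 2 * D * r * Real.log T + (3 * N ^ 2 + 4 * E) * (r * Real.log T) := by
        linarith
    _ = _ := by rw [rateConst]; ring

theorem IsRandomFeature.lintegral_rhoNorm_iterate_le
    (hy : Integrable (fun z : X × ℝ => z.2 ^ 2) ρ) (hφ : IsRandomFeature K μ φ ρ)
    (hb : BoundedBy κ K μ φ ρ) (hζ : 0 < ζ) (hs : SourceCondition ζ R K ρ) (hγ : 0 ≤ γ)
    (hγ1 : γ ≤ 1) (hc : 0 < cγ) (hcap : CapacityCondition γ cγ K ρ) {Ω : Type*}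
    [MeasurableSpace Ω] {P : Measure Ω} (hT : 2 ≤ T)
    {z : ℕ → Ω → X × ℝ} {v : ℕ → Ω → V}
    (hlaw : ∀ t < T, HasLaw (fun ω => (z t ω, v t ω)) (ρ.prod μ) P)
    (hind : iIndepFun (fun (t : Fin T) ω => (z t ω, v t ω)) P) :
    ∫⁻ ω, rhoNorm ρ (fun x => iterate φ (fun _ => stepSize κ cγ γ ζ T) 0
        (fun t => z t ω) (fun t => v t ω) T x - regressionFunction ρ x) ^ 2 ∂P ≤
      ENNReal.ofReal (rateConst R ζ (rhoNorm ρ (regressionFunction ρ)).toReal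
        (expectedRisk ρ (regressionFunction ρ)) κ cγ *
          (T : ℝ) ^ (-(2 * ζ / (2 * ζ + γ + 1))) * Real.log T) := by
  have : Nonempty ((X × ℝ) × V) := (ρ.prod μ).nonempty_of_neZero
  have hρ := hs.memLp
  obtain ⟨G, hGsub, hGm, hG⟩ := (hb.ae_feature).exists_measurable_mem
  -- Setting `φ` to zero off the full-measure set `G` makes every section bounded. The kernel
  -- integrals are unchanged, and almost surely all sampled `v t` lie in `G`.
  set φ' : V → X → ℝ := G.indicator φ with hφ'
  have heq : ∀ v ∈ G, φ' v = φ v := fun v hv => Set.indicator_of_mem hv φ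
  have hφ'b : IsBoundedFeature φ' ρ.fst κ := by
    refine ⟨?_, fun v => ?_⟩
    · have h1 : (fun p : V × X => φ' p.1 p.2) =
          (G ×ˢ (Set.univ : Set X)).indicator fun p => φ p.1 p.2 := by
        funext p
        by_cases hp : p.1 ∈ G <;> simp [hφ', hp]
      rw [h1]
      exact hφ.measurable.indicator (hGm.prod .univ)
    · by_cases hv : v ∈ G
      · rw [heq v hv]; exact hG v hv
      · refine .of_forall fun x => ?_
        simpa [hφ', hv] using zero_le_one.trans hb.one_le
  have hL : IsMeanRankOne (LK K ρ) μ (fun v => toL2 ρ.fst (φ' v)) κ := by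
    refine hφ'b.isMeanRankOne (hφ.kernelMemL2 hb) fun x x' => ?_
    rw [hφ.kernel_eq]
    refine integral_congr_ae ?_
    filter_upwards [hGsub] with v hv
    rw [heq v hv]
  refine le_trans (le_of_eq ?_)
    (hφ'b.meanSqError_le_rate hL hb.one_le hy hζ hs hγ hγ1 hc hcap hT)
  have hmeas : ∀ t : Fin T, AEMeasurable (fun ω => (z t ω, v t ω)) P :=
    fun t => (hlaw t t.2).aemeasurable
  have hmap : P.map (fun ω (t : Fin T) => (z t ω, v t ω)) = Measure.pi fun _ => ρ.prod μ := by
    rw [hind.map_fun_eq_pi_map hmeas]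
    congr 1
    funext t
    exact (hlaw t t.2).map_eq
  rw [meanSqError, ← hmap, lintegral_map' _ (aemeasurable_pi_lambda _ hmeas)]
  · have hgood : ∀ᵐ ω ∂P, ∀ t : Fin T, v t ω ∈ G := by
      refine ae_all_iff.2 fun t => ?_
      have h1 : ∀ᵐ s ∂(ρ.prod μ), s.2 ∈ G := Measure.quasiMeasurePreserving_snd.ae hGsub
      rw [← (hlaw t t.2).map_eq] at h1
      exact ae_of_ae_map (hmeas t) h1
    refine lintegral_congr_ae ?_
    filter_upwards [hgood] with ω hω
    -- Only indices below `T` are read, so the default value in `extendFin` never enters.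
    have h1 : iterate φ (fun _ => stepSize κ cγ γ ζ T) 0 (fun t => z t ω) (fun t => v t ω) T =
        sampleIterate φ' (stepSize κ cγ γ ζ T) T (fun t : Fin T => (z t ω, v t ω)) := by
      refine iterate_congr (fun n hn => ?_) fun n hn => ?_
      · simp [extendFin, hn]
      · simp only [extendFin, hn, dif_pos]
        exact (heq _ (hω ⟨n, hn⟩)).symm
    rw [h1]
    exact (ofReal_norm_toL2_sub_sq (memLp_iterate hφ'b.memLp _ _ T) hρ).symm
  · exact (hφ'b.measurable_norm_sampleIterate _ _ _ T).aemeasurable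

end Rate

end DoublyStochastic

end

theorem mainTheorem2 :
    ∃ C : (R ζ normFρ riskFρ κ cγ : ℝ) → ℝ,
      ∀ (d : ℕ) (X : Set (EuclideanSpace ℝ (Fin d))) (_ : IsClosed X)
        (ρ : MeasureTheory.Measure (X × ℝ)) [MeasureTheory.IsProbabilityMeasure ρ]
        (_ : MeasureTheory.Integrable (fun z : X × ℝ => z.2 ^ 2) ρ)
        (V : Type*) [MeasurableSpace V]
        (μ : MeasureTheory.Measure V) [MeasureTheory.IsProbabilityMeasure μ]
        (K : X → X → ℝ) (φ : V → X → ℝ) (_ : DoublyStochastic.IsRandomFeature K μ φ ρ)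
        (κ : ℝ) (_ : DoublyStochastic.BoundedBy κ K μ φ ρ)
        (ζ R : ℝ) (_ : 0 < ζ) (_ : 0 < R) (_ : DoublyStochastic.SourceCondition ζ R K ρ)
        (γ cγ : ℝ) (_ : 0 ≤ γ) (_ : γ ≤ 1) (_ : 0 < cγ)
        (_ : DoublyStochastic.CapacityCondition γ cγ K ρ)
        (Ω : Type*) [MeasurableSpace Ω]
        (P : MeasureTheory.Measure Ω) [MeasureTheory.IsProbabilityMeasure P]
        (T : ℕ) (_ : 2 ≤ T)
        (z : ℕ → Ω → X × ℝ) (v : ℕ → Ω → V)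
        (_ : ∀ t < T, ProbabilityTheory.HasLaw (fun ω => (z t ω, v t ω)) (ρ.prod μ) P)
        (_ : ProbabilityTheory.iIndepFun (fun (t : Fin T) ω => (z t ω, v t ω)) P),
        ∫⁻ ω, DoublyStochastic.rhoNorm ρ (fun x =>
            DoublyStochastic.iterate φ (fun _ => DoublyStochastic.stepSize κ cγ γ ζ T) 0
              (fun t => z t ω) (fun t => v t ω) T x
            - DoublyStochastic.regressionFunction ρ x) ^ 2 ∂P
          ≤ ENNReal.ofReal
              (C R ζ (DoublyStochastic.rhoNorm ρ (DoublyStochastic.regressionFunction ρ)).toReal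
                  (DoublyStochastic.expectedRisk ρ (DoublyStochastic.regressionFunction ρ)) κ cγ
                * (T : ℝ) ^ (-(2 * ζ / (2 * ζ + γ + 1))) * Real.log T) := by
  refine ⟨DoublyStochastic.rateConst, ?_⟩
  intro d X _ ρ _ hy V _ μ _ K φ hφ κ hb ζ R hζ _ hs γ cγ hγ hγ1 hc hcap Ω _ P _ T hT z v hlaw hind
  exact hφ.lintegral_rhoNorm_iterate_le hy hb hζ hs hγ hγ1 hc hcap hT hlaw hind
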